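/- For complex numbers $a,q$ with $|q|<1$ and an integer $m\ge 0$ let $(a;q)_m=\prod_{j=0}^{m-1}(1-aq^j)$, $(a;q)_\infty=\prod_{j=0}^{\infty}(1-aq^j)$ and $(a_1,a_2,a_3;q)_\infty=(a_1;q)_\infty(a_2;q)_\infty(a_3;q)_\infty$. Then for every complex $q$ with $|q|<1$ the following six identities hold (in the fourth one $q\neq 0$ is assumed), where all double sums over integers $n,r\ge 0$ converge absolutely: $$\sum_{n,r\ge 0}\frac{q^{n^2+2r^2+2nr+2n+3r}\,(q;q)_{n+r+1}}{(q;q)_{2n+2r+2}(q;q)_r(q;q)_n}=\frac{(q,q^{12},q^{13};q^{13})_\infty}{(q;q)_\infty},$$ $$\sum_{n,r\ge 0}\frac{q^{n^2+2r^2+2nr+2n+3r}\,(q;q)_{n+r+1}\,(1+q^{r+1}+q^{n+1}-q^{n+r+1})}{(q;q)_{2n+2r+2}(q;q)_r(q;q)_n}=\frac{(q^2,q^{11},q^{13};q^{13})_\infty}{(q;q)_\infty},$$ $$\sum_{n,r\ge 0}\frac{q^{n^2+2r^2+2nr+2n+3r}\,(q;q)_{n+r+1}}{(q;q)_{2n+2r+2}(q;q)_r(q;q)_n}\Big((1-q^{n+r+1})(q^r+q^n)(1+q)-q^{n+r}+q^{2r+2}+q^{2n+2}+q^{2n+2r+1}+q^{n+r+2}\Big)=\frac{(q^3,q^{10},q^{13};q^{13})_\infty}{(q;q)_\infty},$$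 $$\sum_{n,r\ge 0}\frac{q^{n^2+2r^2+2nr-1}\,(q;q)_{n+r}}{(q;q)_{2n+2r}(q;q)_r(q;q)_n}\Big(q^r-1+q^{2r+1}+q^{n+r+1}-q^{n+2r}+q^n+q^{2n+1}-q^{2n+r}-q^{n+2r+1}-q^{2n+r+1}+q^{2n+2r}\Big)=\frac{(q^4,q^9,q^{13};q^{13})_\infty}{(q;q)_\infty},$$ $$\sum_{n,r\ge 0}\frac{q^{n^2+2r^2+2nr}\,(q;q)_{n+r}\,(q^n+q^r-q^{n+r})}{(q;q)_{2n+2r}(q;q)_r(q;q)_n}=\frac{(q^5,q^8,q^{13};q^{13})_\infty}{(q;q)_\infty},$$ $$\sum_{n,r\ge 0}\frac{q^{n^2+2r^2+2nr}\,(q;q)_{n+r}}{(q;q)_{2n+2r}(q;q)_r(q;q)_n}=\frac{(q^6,q^7,q^{13};q^{13})_\infty}{(q;q)_\infty}.$$ -/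

import Mathlib

noncomputable section

namespace QSeries

/-- The finite `q`-shifted factorial `(a; q)_m = ∏_{j=0}^{m-1} (1 - a q^j)`. -/
def qPoch (a q : ℂ) (m : ℕ) : ℂ := ∏ j ∈ Finset.range m, (1 - a * q ^ j)

/-- The infinite `q`-shifted factorial `(a; q)_∞ = ∏_{j ≥ 0} (1 - a q^j)`, for `|q| < 1`. -/
def qPochInf (a q : ℂ) : ℂ := ∏' j : ℕ, (1 - a * q ^ j)

/-- The product `(a₁, a₂, a₃; q)_∞ = (a₁; q)_∞ (a₂; q)_∞ (a₃; q)_∞`. -/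
def qPochInf₃ (a₁ a₂ a₃ q : ℂ) : ℂ := qPochInf a₁ q * qPochInf a₂ q * qPochInf a₃ q

/-- The infinite product defining `(a; q)_∞` converges whenever `|q| < 1`. -/
theorem multipliable_qPochInf (a : ℂ) {q : ℂ} (hq : ‖q‖ < 1) :
    Multipliable fun j : ℕ => 1 - a * q ^ j := by
  have h : Summable fun j : ℕ => -(a * q ^ j) :=
    ((summable_geometric_of_norm_lt_one hq).mul_left a).neg
  simpa only [sub_eq_add_neg] using Complex.multipliable_one_add_of_summable h

end QSeries

end

/-! Each identity is Bailey's lemma applied to a polynomial identity of Rogers–Ramanujan type. Write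
`q = s ^ 2`. The limiting Bailey lemma for `a = 1` (`hasSum_bailey`) turns `∑_j α_j / ((q)_{N-c_j}
(q)_{N+c_j})`, weighted by `q^{N^2}` and summed over `N`, into `(q)_∞⁻¹ ∑_j q^{c_j^2} α_j`. For `α_j
= (-1)^j s^{j(5j+a)}` and `c_j = 2j` or `2j+1`, the factor `q^{c_j^2}` raises `5j^2` to `13j^2`, and
Jacobi's triple product (`tsum_jacobi_thirteen`) gives the modulus 13 products.

It remains to evaluate the finite alternating sums `gsum`, which are `(q)_{2N}` times the Bailey
sums. The basic case is Bressoud's finite Rogers–Ramanujan identity `∑_j (-1)^j q^{j(5j+1)/2} [2m,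
m+2j] = ∑_r q^{r^2} [m, r]` (`gsum_eq_rsum`). The two q-Pascal rules and the symmetries `j ↦ -j`, `j
↦ j+1` then express every other `gsum` needed through the polynomials `rsum`.

With `N = n + r`, a factor `q^n` equals `q^N / q^r`, so a polynomial weight in `q^n, q^r` shifts the
index `k` of `rsum`. The weights in the theorem are these combinations of `rsum`, and unfolding `[N,
r]` gives the double series. -/

noncomputable section

namespace QSeries

/-! ### Gaussian binomials with integer lower index -/

/-- The reciprocal `1 / (q; q)_k`, extended by `0` to negative `k`. -/
def rPoch (q : ℂ) (k : ℤ) : ℂ := if k < 0 then 0 else (qPoch q q k.toNat)⁻¹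

/-- The Gaussian binomial coefficient `[M, k]_q`, which vanishes unless `0 ≤ k ≤ M`. -/
def gbin (q : ℂ) (M : ℕ) (k : ℤ) : ℂ := qPoch q q M * rPoch q k * rPoch q (M - k)

/-- The sum `∑_j α_j [M, c + d j]_q` over all integers `j`. -/
def bisum (q : ℂ) (d : ℤ) (M : ℕ) (c : ℤ) (α : ℤ → ℂ) : ℂ := ∑' j : ℤ, α j * gbin q M (c + d * j)

theorem one_sub_pow_succ_ne_zero {q : ℂ} (hq : ‖q‖ < 1) (n : ℕ) : 1 - q ^ (n + 1) ≠ 0 := by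
  intro h
  have h1 : ‖q ^ (n + 1)‖ < 1 := by
    rw [norm_pow]; exact pow_lt_one₀ (norm_nonneg _) hq (by omega)
  rw [← sub_eq_zero.mp h] at h1
  simp at h1

theorem qPoch_succ (q : ℂ) (n : ℕ) : qPoch q q (n + 1) = qPoch q q n * (1 - q ^ (n + 1)) := by
  rw [qPoch, Finset.prod_range_succ, ← qPoch, pow_succ']

theorem qPoch_ne_zero {q : ℂ} (hq : ‖q‖ < 1) (n : ℕ) : qPoch q q n ≠ 0 := by
  induction n with
  | zero => simp [qPoch]
  | succ n ih => rw [qPoch_succ]; exact mul_ne_zero ih (one_sub_pow_succ_ne_zero hq n)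

theorem rPoch_natCast (q : ℂ) (n : ℕ) : rPoch q n = (qPoch q q n)⁻¹ := by
  simp [rPoch]

theorem rPoch_of_neg (q : ℂ) {k : ℤ} (hk : k < 0) : rPoch q k = 0 := by
  simp [rPoch, hk]

/-- At `k = 0` the factor `1 - q ^ 0` vanishes, matching the extension by zero. Hence the Pascal
rules below need no boundary cases. -/
theorem rPoch_sub_one {q : ℂ} (hq : ‖q‖ < 1) (k : ℤ) :
    rPoch q (k - 1) = (1 - q ^ k) * rPoch q k := by
  rcases lt_trichotomy k 0 with h | h | h
  · rw [rPoch_of_neg q h, rPoch_of_neg q (by omega), mul_zero]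
  · subst h; rw [rPoch_of_neg q (by omega)]; simp
  · obtain ⟨n, rfl⟩ : ∃ n : ℕ, k = (n + 1 : ℕ) := ⟨(k - 1).toNat, by omega⟩
    rw [rPoch_natCast, show ((n + 1 : ℕ) : ℤ) - 1 = (n : ℕ) by push_cast; ring, rPoch_natCast,
      qPoch_succ, zpow_natCast]
    have := one_sub_pow_succ_ne_zero hq n
    have := qPoch_ne_zero hq n
    field_simp

theorem gbin_of_neg (q : ℂ) (M : ℕ) {k : ℤ} (hk : k < 0) : gbin q M k = 0 := by
  simp [gbin, rPoch_of_neg q hk]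

theorem gbin_of_lt (q : ℂ) (M : ℕ) {k : ℤ} (hk : M < k) : gbin q M k = 0 := by
  simp [gbin, rPoch_of_neg q (show (M : ℤ) - k < 0 by omega)]

theorem gbin_zero_zero (q : ℂ) : gbin q 0 0 = 1 := by
  simp [gbin, rPoch, qPoch]

theorem gbin_symm (q : ℂ) (M : ℕ) (k : ℤ) : gbin q M (M - k) = gbin q M k := by
  simp only [gbin, sub_sub_cancel]; ring

theorem gbin_succ {q : ℂ} (hq : ‖q‖ < 1) (hq0 : q ≠ 0) (M : ℕ) (k : ℤ) :
    gbin q (M + 1) k = gbin q M (k - 1) + q ^ k * gbin q M k := by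
  have h1 := rPoch_sub_one hq k
  have h2 := rPoch_sub_one hq ((M + 1 : ℕ) - k)
  have e1 : ((M + 1 : ℕ) : ℤ) - k - 1 = M - k := by push_cast; ring
  have e2 : (M : ℤ) - (k - 1) = (M + 1 : ℕ) - k := by push_cast; ring
  have e3 : q ^ (((M + 1 : ℕ) : ℤ) - k) = q ^ (M + 1) * (q ^ k)⁻¹ := by
    rw [zpow_sub₀ hq0, zpow_natCast]; rfl
  have hk : q ^ k ≠ 0 := zpow_ne_zero _ hq0
  rw [e1, e3] at h2
  simp only [gbin]
  rw [e2, h1, h2, qPoch_succ]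
  field_simp
  ring

theorem gbin_succ' {q : ℂ} (hq : ‖q‖ < 1) (hq0 : q ≠ 0) (M : ℕ) (k : ℤ) :
    gbin q (M + 1) k = gbin q M k + q ^ ((M : ℤ) + 1 - k) * gbin q M (k - 1) := by
  rw [← gbin_symm, gbin_succ hq hq0, ← gbin_symm q M k, ← gbin_symm q M (k - 1),
    show ((M + 1 : ℕ) : ℤ) - k = M + 1 - k by push_cast; ring,
    show (M : ℤ) + 1 - k - 1 = M - k by ring, show (M : ℤ) - (k - 1) = M + 1 - k by ring]

/-! ### Bilateral sums of Gaussian binomials -/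

theorem summable_bisum (q : ℂ) {d : ℤ} (hd : d ≠ 0) (M : ℕ) (c : ℤ) (α : ℤ → ℂ) :
    Summable fun j : ℤ => α j * gbin q M (c + d * j) := by
  have hinj : Function.Injective fun j : ℤ => c + d * j := fun x y h => by
    simpa [hd] using h
  refine summable_of_hasFiniteSupport (((Set.finite_Icc (0 : ℤ) M).preimage
    hinj.injOn).subset fun j hj => ?_)
  simp only [Set.mem_preimage, Set.mem_Icc]
  by_contra h
  rw [not_and_or, not_le, not_le] at h
  rcases h with h | h
  · exact hj (by simp [gbin_of_neg q M h])
  · exact hj (by simp [gbin_of_lt q M h])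

theorem bisum_const_mul (q : ℂ) (d : ℤ) (M : ℕ) (c : ℤ) (x : ℂ) (α : ℤ → ℂ) :
    bisum q d M c (fun j => x * α j) = x * bisum q d M c α := by
  simp only [bisum, mul_assoc, tsum_mul_left]

theorem bisum_shift (q : ℂ) (d : ℤ) (M : ℕ) (c : ℤ) (α : ℤ → ℂ) :
    bisum q d M c α = bisum q d M (c + d) (fun j => α (j + 1)) := by
  rw [bisum, bisum, ← (Equiv.addRight (1 : ℤ)).tsum_eq]
  refine tsum_congr fun j => ?_
  simp only [Equiv.coe_addRight]
  congr 2; ring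

theorem bisum_reflect (q : ℂ) (d : ℤ) (M : ℕ) (c : ℤ) (α : ℤ → ℂ) :
    bisum q d M c α = bisum q d M (M - c) (fun j => α (-j)) := by
  rw [bisum, bisum, ← (Equiv.neg ℤ).tsum_eq]
  refine tsum_congr fun j => ?_
  simp only [Equiv.neg_apply]
  rw [← gbin_symm]
  congr 2; ring

theorem bisum_succ {q : ℂ} (hq : ‖q‖ < 1) (hq0 : q ≠ 0) {d : ℤ} (hd : d ≠ 0) (M : ℕ) (c : ℤ)
    (α : ℤ → ℂ) :
    bisum q d (M + 1) c α =
      bisum q d M (c - 1) α + bisum q d M c (fun j => q ^ (c + d * j) * α j) := by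
  simp only [bisum]
  rw [← (summable_bisum q hd M _ _).tsum_add (summable_bisum q hd M _ _)]
  refine tsum_congr fun j => ?_
  rw [gbin_succ hq hq0, show c + d * j - 1 = c - 1 + d * j by ring]
  ring

theorem bisum_succ' {q : ℂ} (hq : ‖q‖ < 1) (hq0 : q ≠ 0) {d : ℤ} (hd : d ≠ 0) (M : ℕ) (c : ℤ)
    (α : ℤ → ℂ) :
    bisum q d (M + 1) c α = bisum q d M c α +
      bisum q d M (c - 1) (fun j => q ^ ((M : ℤ) + 1 - (c + d * j)) * α j) := by
  simp only [bisum]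
  rw [← (summable_bisum q hd M _ _).tsum_add (summable_bisum q hd M _ _)]
  refine tsum_congr fun j => ?_
  rw [gbin_succ' hq hq0, show c + d * j - 1 = c - 1 + d * j by ring]
  ring

/-! ### Recurrences and symmetries of `rsum` and `gsum` -/

/-- The polynomial `∑_r q^{r^2 + k r} [N, r]_q`. -/
def rsum (q : ℂ) (k : ℤ) (N : ℕ) : ℂ := bisum q 1 N 0 fun r => q ^ (r ^ 2 + k * r)

/-- The polynomial `∑_j (-1)^j q^{j (5 j + a) / 2} [M, c + 2 j]_q`, where `q = s^2`. -/
def gsum (s : ℂ) (M : ℕ) (c a : ℤ) : ℂ :=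
  bisum (s ^ 2) 2 M c fun j => (-1) ^ j * s ^ (j * (5 * j + a))

theorem rsum_zero (q : ℂ) (k : ℤ) : rsum q k 0 = 1 := by
  rw [rsum, bisum, tsum_eq_single 0]
  · simp [gbin_zero_zero]
  · intro j hj
    rcases lt_or_gt_of_ne hj with h | h
    · rw [gbin_of_neg _ _ (by omega), mul_zero]
    · rw [gbin_of_lt _ _ (by push_cast; omega), mul_zero]

theorem rsum_succ {q : ℂ} (hq : ‖q‖ < 1) (hq0 : q ≠ 0) (k : ℤ) (N : ℕ) :
    rsum q k (N + 1) = rsum q (k + 1) N + q ^ (k + 1) * rsum q (k + 2) N := by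
  rw [rsum, bisum_succ hq hq0 one_ne_zero, bisum_shift, add_comm]
  simp only [rsum]
  rw [← bisum_const_mul]
  simp only [← zpow_add₀ hq0]
  rw [show (0 : ℤ) - 1 + 1 = 0 by ring]
  congr 2 <;>
  · funext j
    congr 1; ring

theorem rsum_succ' {q : ℂ} (hq : ‖q‖ < 1) (hq0 : q ≠ 0) (k : ℤ) (N : ℕ) :
    rsum q k (N + 1) = rsum q k N + q ^ (N + 1 + k) * rsum q (k + 1) N := by
  rw [rsum, bisum_succ' hq hq0 one_ne_zero, bisum_shift _ _ _ (0 - 1)]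
  simp only [rsum]
  rw [← bisum_const_mul]
  simp only [← zpow_add₀ hq0]
  congr 2
  funext j
  congr 1; ring

theorem rsum_contiguous {q : ℂ} (hq : ‖q‖ < 1) (hq0 : q ≠ 0) (k : ℤ) (N : ℕ) :
    rsum q k N = (1 - q ^ (N + 1 + k)) * rsum q (k + 1) N + q ^ (k + 1) * rsum q (k + 2) N := by
  linear_combination rsum_succ hq hq0 k N - rsum_succ' hq hq0 k N

theorem rsum_sub_rsum {q : ℂ} (hq : ‖q‖ < 1) (hq0 : q ≠ 0) (k : ℤ) (N : ℕ) :
    rsum q k (N + 1) - rsum q (k + 1) (N + 1) =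
      q ^ (k + 1) * (1 - q ^ (N + 1)) * rsum q (k + 2) N := by
  have h := rsum_succ' hq hq0 (k + 1) N
  rw [show (N : ℤ) + 1 + (k + 1) = (k + 1) + (N + 1 : ℕ) by push_cast; ring, zpow_add₀ hq0,
    zpow_natCast, show k + 1 + 1 = k + 2 by ring] at h
  linear_combination rsum_succ hq hq0 k N - h

/-- The Pascal factor `q^{c+2j} = s^{2c} s^{4j}` is absorbed by raising `a` by 4; the other Pascal
rule lowers it by 4. -/
theorem gsum_succ {s : ℂ} (hs : ‖s ^ 2‖ < 1) (hs0 : s ≠ 0) (M : ℕ) (c a : ℤ) :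
    gsum s (M + 1) c a = gsum s M (c - 1) a + s ^ (2 * c) * gsum s M c (a + 4) := by
  rw [gsum, bisum_succ hs (pow_ne_zero 2 hs0) two_ne_zero]
  simp only [gsum]
  rw [← bisum_const_mul]
  congr 2
  funext j
  rw [← zpow_natCast, ← zpow_mul, mul_left_comm, mul_left_comm (s ^ (2 * c)), ← zpow_add₀ hs0,
    ← zpow_add₀ hs0]
  congr 2; push_cast; ring

theorem gsum_succ' {s : ℂ} (hs : ‖s ^ 2‖ < 1) (hs0 : s ≠ 0) (M : ℕ) (c a : ℤ) :
    gsum s (M + 1) c a =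
      gsum s M c a + s ^ (2 * (M + 1 - c)) * gsum s M (c - 1) (a - 4) := by
  rw [gsum, bisum_succ' hs (pow_ne_zero 2 hs0) two_ne_zero]
  simp only [gsum]
  rw [← bisum_const_mul]
  congr 2
  funext j
  rw [← zpow_natCast, ← zpow_mul, mul_left_comm, mul_left_comm (s ^ (2 * _)), ← zpow_add₀ hs0,
    ← zpow_add₀ hs0]
  congr 2; push_cast; ring

theorem gsum_reflect (s : ℂ) (M : ℕ) (c a : ℤ) : gsum s M c a = gsum s M (M - c) (-a) := by
  rw [gsum, bisum_reflect, gsum]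
  congr 1
  funext j
  rw [zpow_neg, ← inv_zpow, inv_neg, inv_one]
  congr 2; ring

theorem gsum_shift {s : ℂ} (hs0 : s ≠ 0) (M : ℕ) (c a : ℤ) :
    gsum s M c a = -s ^ (5 + a) * gsum s M (c + 2) (a + 10) := by
  rw [gsum, bisum_shift, gsum, ← bisum_const_mul]
  congr 1
  funext j
  rw [zpow_add_one₀ (by norm_num), show (j + 1) * (5 * (j + 1) + a) =
    (5 + a) + j * (5 * j + (a + 10)) by ring, zpow_add₀ hs0]
  ring

theorem gsum_even_zero (s : ℂ) (a : ℤ) : gsum s 0 0 a = 1 := by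
  rw [gsum, bisum, tsum_eq_single 0]
  · simp [gbin_zero_zero]
  · intro j hj
    rcases lt_or_gt_of_ne hj with h | h
    · rw [gbin_of_neg _ _ (by omega), mul_zero]
    · rw [gbin_of_lt _ _ (by push_cast; omega), mul_zero]

theorem gsum_odd_zero (s : ℂ) (a : ℤ) : gsum s 0 1 a = 0 := by
  rw [gsum, bisum]
  refine (tsum_congr fun j => ?_).trans tsum_zero
  rcases lt_or_ge j 0 with h | h
  · rw [gbin_of_neg _ _ (by omega), mul_zero]
  · rw [gbin_of_lt _ _ (by push_cast; omega), mul_zero]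

theorem gsum_even_neg (s : ℂ) (m : ℕ) (a : ℤ) : gsum s (2 * m) m a = gsum s (2 * m) m (-a) := by
  rw [gsum_reflect, show ((2 * m : ℕ) : ℤ) - m = m by push_cast; ring]

theorem gsum_odd_reflect {s : ℂ} (hs0 : s ≠ 0) (m : ℕ) (a : ℤ) :
    gsum s (2 * m) (m + 1) a = -s ^ (5 - a) * gsum s (2 * m) (m + 1) (10 - a) := by
  rw [gsum_reflect, gsum_shift hs0, show ((2 * m : ℕ) : ℤ) - (m + 1) + 2 = m + 1 by push_cast; ring]
  ring_nf

/-- The reflection `a ↦ 10 - a` fixes 5 and reverses the sign. This vanishing is what closes the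
system of recurrences. -/
theorem gsum_odd_five {s : ℂ} (hs0 : s ≠ 0) (m : ℕ) : gsum s (2 * m) (m + 1) 5 = 0 := by
  have h := gsum_odd_reflect hs0 m 5
  norm_num at h
  exact self_eq_neg.mp h

theorem gsum_middle_eq {s : ℂ} (hs : ‖s ^ 2‖ < 1) (hs0 : s ≠ 0) (m : ℕ) (a : ℤ) :
    gsum s (2 * m + 1) (m + 1) a =
      gsum s (2 * m) m a + s ^ (2 * m + 2) * gsum s (2 * m) (m + 1) (a + 4) := by
  rw [gsum_succ hs hs0, add_sub_cancel_right, ← zpow_natCast s (2 * m + 2)]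
  congr 2

theorem gsum_middle_eq' {s : ℂ} (hs : ‖s ^ 2‖ < 1) (hs0 : s ≠ 0) (m : ℕ) (a : ℤ) :
    gsum s (2 * m + 1) (m + 1) a =
      gsum s (2 * m) (m + 1) a + s ^ (2 * m) * gsum s (2 * m) m (a - 4) := by
  rw [gsum_succ' hs hs0]
  congr 2
  · rw [← zpow_natCast]; congr 1; push_cast; ring
  · ring_nf

theorem gsum_odd_succ {s : ℂ} (hs : ‖s ^ 2‖ < 1) (hs0 : s ≠ 0) (m : ℕ) (a : ℤ) :
    gsum s (2 * (m + 1)) ((m + 1 : ℕ) + 1) a = gsum s (2 * m + 1) (m + 1) a -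
      s ^ (2 * m + 5 - a) * gsum s (2 * m + 1) (m + 1) (6 - a) := by
  have h : gsum s (2 * m + 1) (m + 2) (a + 4) =
      -s ^ (1 - a) * gsum s (2 * m + 1) (m + 1) (6 - a) := by
    rw [gsum_reflect, gsum_shift hs0,
      show ((2 * m + 1 : ℕ) : ℤ) - (m + 2) + 2 = m + 1 by push_cast; ring]
    ring_nf
  rw [show 2 * (m + 1) = 2 * m + 1 + 1 by ring, gsum_succ hs hs0,
    show ((m + 1 : ℕ) : ℤ) + 1 = m + 2 by push_cast; ring, h,
    show (2 * m + 5 - a : ℤ) = 2 * (m + 2) + (1 - a) by ring, zpow_add₀ hs0,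
    show (m + 2 - 1 : ℤ) = m + 1 by ring]
  ring

theorem gsum_even_succ {s : ℂ} (hs : ‖s ^ 2‖ < 1) (hs0 : s ≠ 0) (m : ℕ) (a : ℤ) :
    gsum s (2 * (m + 1)) (m + 1 : ℕ) a = gsum s (2 * m + 1) (m + 1) a +
      s ^ (2 * m + 2) * gsum s (2 * m + 1) (m + 1) (4 - a) := by
  rw [show 2 * (m + 1) = 2 * m + 1 + 1 by ring, gsum_succ' hs hs0,
    gsum_reflect _ _ _ (a - 4)]
  congr 2
  · rw [← zpow_natCast]; congr 1; push_cast; ring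
  · congr 1 <;> push_cast <;> ring

/-- Bressoud's identity and its companion in the odd row are proved jointly, since each row feeds
the next. By `gsum_odd_five` the sum with `a = 1` passes unchanged from row `2m` to row `2m+1`. The
recurrences then agree with those of `rsum`. -/
theorem gsum_eq_rsum {s : ℂ} (hs : ‖s ^ 2‖ < 1) (hs0 : s ≠ 0) (m : ℕ) :
    gsum s (2 * m) m 1 = rsum (s ^ 2) 0 m ∧ gsum s (2 * m + 1) (m + 1) 3 = rsum (s ^ 2) 1 m := by
  have hq0 : s ^ 2 ≠ 0 := pow_ne_zero 2 hs0
  induction m with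
  | zero =>
    have h := gsum_middle_eq' hs hs0 0 3
    simp only [mul_zero, Nat.cast_zero, zero_add, gsum_odd_zero, gsum_even_zero] at h
    simp only [mul_zero, Nat.cast_zero, zero_add, gsum_even_zero, rsum_zero]
    simpa using h
  | succ m ih =>
    obtain ⟨ih0, ih1⟩ := ih
    have e1 := gsum_even_succ hs hs0 m 1
    have x1 := gsum_middle_eq hs hs0 m 1
    have o5 := gsum_odd_five hs0 m
    have x3 := gsum_middle_eq' hs hs0 (m + 1) 3
    have o3 := gsum_odd_succ hs hs0 m 3
    have e' := gsum_even_neg s (m + 1) 1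
    have t0 := rsum_succ' hs hq0 0 m
    have d0 := rsum_sub_rsum hs hq0 (-1) m
    have c0 := rsum_contiguous hs hq0 (-1) (m + 1)
    rw [show (2 * m + 5 - 3 : ℤ) = (2 * m + 2 : ℕ) by push_cast; ring, zpow_natCast] at o3
    rw [show (m + 1 + 0 : ℤ) = (m + 1 : ℕ) by push_cast; ring, zpow_natCast] at t0
    rw [show ((m + 1 : ℕ) + 1 + -1 : ℤ) = (m + 1 : ℕ) by push_cast; ring, zpow_natCast] at c0
    norm_num at e1 x1 x3 o3 e' t0 d0 c0 o5
    have E : gsum s (2 * (m + 1)) (m + 1) 1 = rsum (s ^ 2) 0 (m + 1) := by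
      rw [e1, x1, ih1, ih0, o5, t0]; ring
    refine ⟨by exact_mod_cast E, ?_⟩
    push_cast
    rw [x3, o3, ← e', E, ih1]
    linear_combination c0 - d0

/-- The values of the alternating sums that occur in the modulus 13 identities. -/
theorem gsum_odd_three {s : ℂ} (hs : ‖s ^ 2‖ < 1) (hs0 : s ≠ 0) (m : ℕ) :
    gsum s (2 * m) (m + 1) 3 = rsum (s ^ 2) (-1) m - rsum (s ^ 2) 0 m := by
  have x3 := gsum_middle_eq' hs hs0 m 3
  have e' := gsum_even_neg s m 1
  have c0 := rsum_contiguous hs (pow_ne_zero 2 hs0) (-1) m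
  obtain ⟨h0, h1⟩ := gsum_eq_rsum hs hs0 m
  rw [show (m + 1 + -1 : ℤ) = (m : ℕ) by ring, zpow_natCast] at c0
  norm_num at x3 c0
  rw [h1, ← e', h0] at x3
  linear_combination - x3 - c0

theorem gsum_even_three {s : ℂ} (hs : ‖s ^ 2‖ < 1) (hs0 : s ≠ 0) (m : ℕ) :
    gsum s (2 * m) m 3 = rsum (s ^ 2) 1 m +
      (s ^ 2) ^ m * (rsum (s ^ 2) (-1) m - rsum (s ^ 2) 0 m) := by
  have x3 := gsum_middle_eq hs hs0 m 3
  have o7 := gsum_odd_reflect hs0 m 3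
  have o3 := gsum_odd_three hs hs0 m
  rw [(gsum_eq_rsum hs hs0 m).2] at x3
  norm_num at x3 o7
  rw [← o3, x3, o7]
  ring

/-- The two Pascal rules expand the same sum in row `2m+1` in two ways; equating them relates
centred and off-centre sums of row `2m`. The next two lemmas do the same for `a = 5` and `a = -1`.
-/
theorem gsum_odd_one {s : ℂ} (hs : ‖s ^ 2‖ < 1) (hs0 : s ≠ 0) (m : ℕ) :
    gsum s (2 * m) (m + 1) 1 = rsum (s ^ 2) 0 m - (s ^ 2) ^ m * gsum s (2 * m) m 3 := by
  have x1 := gsum_middle_eq hs hs0 m 1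
  have x1' := gsum_middle_eq' hs hs0 m 1
  have o5 := gsum_odd_five hs0 m
  have e' := gsum_even_neg s m 3
  have h0 := (gsum_eq_rsum hs hs0 m).1
  norm_num at x1 x1' o5
  rw [← e'] at x1'
  rw [o5] at x1
  linear_combination x1 - x1' + h0

theorem mul_gsum_even_five {s : ℂ} (hs : ‖s ^ 2‖ < 1) (hs0 : s ≠ 0) (m : ℕ) :
    s ^ 2 * gsum s (2 * m) m 5 =
      (s ^ 2) ^ (m + 1) * rsum (s ^ 2) 0 m + (s ^ 2) ^ m * gsum s (2 * m) (m + 1) 1 := by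
  have x5 := gsum_middle_eq hs hs0 m 5
  have x5' := gsum_middle_eq' hs hs0 m 5
  have o5 := gsum_odd_five hs0 m
  have o9 := gsum_odd_reflect hs0 m 1
  have h0 := (gsum_eq_rsum hs hs0 m).1
  norm_num at x5 x5' o5 o9
  rw [o5] at x5'
  linear_combination s ^ 2 * (x5' - x5) - (s ^ 2) ^ m * o9 + (s ^ 2) ^ (m + 1) * h0

theorem gsum_odd_neg_one {s : ℂ} (hs : ‖s ^ 2‖ < 1) (hs0 : s ≠ 0) (m : ℕ) :
    gsum s (2 * m) (m + 1) (-1) = rsum (s ^ 2) 0 m +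
      (s ^ 2) ^ (m + 1) * gsum s (2 * m) (m + 1) 3 - (s ^ 2) ^ m * gsum s (2 * m) m 5 := by
  have x := gsum_middle_eq hs hs0 m (-1)
  have x' := gsum_middle_eq' hs hs0 m (-1)
  have e1 := gsum_even_neg s m 1
  have e5 := gsum_even_neg s m 5
  have h0 := (gsum_eq_rsum hs hs0 m).1
  norm_num at x x'
  rw [← e1] at x
  rw [← e5] at x'
  linear_combination x - x' + h0

/-! ### Durfee rectangle sums -/

open Filter Topology

theorem tendsto_qPoch (a : ℂ) {q : ℂ} (hq : ‖q‖ < 1) :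
    Tendsto (qPoch a q) atTop (𝓝 (qPochInf a q)) :=
  (multipliable_qPochInf a hq).tendsto_prod_tprod_nat

theorem qPochInf_ne_zero {q : ℂ} (hq : ‖q‖ < 1) : qPochInf q q ≠ 0 := by
  have h := tprod_one_add_ne_zero_of_summable (f := fun j : ℕ => -(q * q ^ j)) (fun j => by
    rw [← sub_eq_add_neg, ← pow_succ']; exact one_sub_pow_succ_ne_zero hq j)
    ((summable_geometric_of_norm_lt_one hq).mul_left q).neg.norm
  simpa only [qPochInf, ← sub_eq_add_neg] using h

theorem tendsto_rPoch {q : ℂ} (hq : ‖q‖ < 1) :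
    Tendsto (fun n : ℕ => rPoch q n) atTop (𝓝 (qPochInf q q)⁻¹) := by
  simp only [rPoch_natCast]
  exact (tendsto_qPoch q hq).inv₀ (qPochInf_ne_zero hq)

theorem exists_norm_qPoch_le {q : ℂ} (hq : ‖q‖ < 1) : ∃ C, ∀ n, ‖qPoch q q n‖ ≤ C := by
  obtain ⟨C, hC⟩ := (Metric.isBounded_range_of_tendsto _ (tendsto_qPoch q hq)).exists_norm_le
  exact ⟨C, fun n => hC _ ⟨n, rfl⟩⟩

theorem exists_norm_rPoch_le {q : ℂ} (hq : ‖q‖ < 1) : ∃ C, 0 ≤ C ∧ ∀ k, ‖rPoch q k‖ ≤ C := by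
  obtain ⟨C, hC⟩ := (Metric.isBounded_range_of_tendsto _ (tendsto_rPoch hq)).exists_norm_le
  have h0 : 0 ≤ C := (norm_nonneg _).trans (hC _ ⟨0, rfl⟩)
  refine ⟨C, h0, fun k => ?_⟩
  rcases lt_or_ge k 0 with h | h
  · rw [rPoch_of_neg q h, norm_zero]; exact h0
  · lift k to ℕ using h
    exact hC _ ⟨k, rfl⟩

/-- The Durfee rectangle sum `∑_m q^{m^2 + l m} / ((q; q)_m (q; q)_{m + l})`. -/
def durfee (q : ℂ) (l : ℕ) : ℂ := ∑' m : ℕ, q ^ (m ^ 2 + l * m) * (rPoch q m * rPoch q (m + l))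

theorem norm_pow_mul_rPoch_le {q : ℂ} (hq : ‖q‖ < 1) {C : ℝ} (h0 : 0 ≤ C)
    (hC : ∀ k, ‖rPoch q k‖ ≤ C) (e e' : ℕ) (he : e ≤ e') (k k' : ℤ) :
    ‖q ^ e' * (rPoch q k * rPoch q k')‖ ≤ ‖q‖ ^ e * (C * C) := by
  rw [norm_mul, norm_mul, norm_pow]
  exact mul_le_mul (pow_le_pow_of_le_one (norm_nonneg _) hq.le he)
    (mul_le_mul (hC _) (hC _) (norm_nonneg _) h0) (by positivity) (by positivity)

theorem summable_durfee {q : ℂ} (hq : ‖q‖ < 1) (l : ℕ) (k : ℤ) :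
    Summable fun m : ℕ => q ^ (m ^ 2 + l * m) * (rPoch q m * rPoch q (m + k)) := by
  obtain ⟨C, h0, hC⟩ := exists_norm_rPoch_le hq
  refine Summable.of_norm_bounded ((summable_geometric_of_lt_one (norm_nonneg q) hq).mul_right
    (C * C)) fun m => norm_pow_mul_rPoch_le hq h0 hC _ _ ?_ _ _
  nlinarith [Nat.le_self_pow two_ne_zero m]

/-- Over the common denominator `(q)_m (q)_{m+l+1}` the difference has numerator `(1 - q^m) -
q^{m+l+1}`. The first part lowers `(q)_m` to `(q)_{m-1}`, and `m ↦ m+1` turns it into `q^{l+1}`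
times the sum for `l+2`. -/
theorem durfee_sub_durfee {q : ℂ} (hq : ‖q‖ < 1) (l : ℕ) :
    durfee q l - durfee q (l + 1) = -q ^ (l + 1) * (durfee q (l + 1) - durfee q (l + 2)) := by
  have hu : Summable fun m : ℕ => q ^ (m ^ 2 + l * m) * (rPoch q (m - 1) * rPoch q (m + l + 1)) := by
    have h := (summable_durfee hq l (l + 1)).sub (summable_durfee hq (l + 1) (l + 1))
    refine h.congr fun m => ?_
    rw [rPoch_sub_one hq, zpow_natCast, ← add_assoc]
    ring
  have h1 : ∑' m : ℕ, q ^ (m ^ 2 + l * m) * (rPoch q (m - 1) * rPoch q (m + l + 1)) =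
      q ^ (l + 1) * durfee q (l + 2) := by
    rw [hu.tsum_eq_zero_add, rPoch_of_neg q (k := ((0 : ℕ) : ℤ) - 1) (by norm_num), durfee,
      ← tsum_mul_left]
    simp only [zero_mul, mul_zero, zero_add]
    refine tsum_congr fun m => ?_
    push_cast
    rw [add_sub_cancel_right, show (m : ℤ) + 1 + l + 1 = m + (l + 2) by ring]
    ring
  have h2 : durfee q l - durfee q (l + 1) =
      (∑' m : ℕ, q ^ (m ^ 2 + l * m) * (rPoch q (m - 1) * rPoch q (m + l + 1))) -
        q ^ (l + 1) * durfee q (l + 1) := by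
    simp only [durfee]
    rw [← (summable_durfee hq l l).tsum_sub (summable_durfee hq (l + 1) (l + 1 : ℕ)),
      ← tsum_mul_left, ← hu.tsum_sub ((summable_durfee hq (l + 1) (l + 1 : ℕ)).mul_left _)]
    refine tsum_congr fun m => ?_
    have e1 := rPoch_sub_one hq m
    have e2 := rPoch_sub_one hq (m + l + 1)
    rw [add_sub_cancel_right, show (m : ℤ) + l + 1 = (m + l + 1 : ℕ) by push_cast; ring,
      zpow_natCast] at e2
    rw [zpow_natCast] at e1
    push_cast at e2 ⊢
    rw [← add_assoc, e1, e2]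
    ring
  rw [h2, h1]
  ring

theorem tendsto_durfee {q : ℂ} (hq : ‖q‖ < 1) :
    Tendsto (durfee q) atTop (𝓝 (qPochInf q q)⁻¹) := by
  obtain ⟨C, h0, hC⟩ := exists_norm_rPoch_le hq
  have h := tendsto_tsum_of_dominated_convergence (𝓕 := atTop)
    (f := fun l m : ℕ => q ^ (m ^ 2 + l * m) * (rPoch q m * rPoch q (m + l)))
    (g := fun m : ℕ => if m = 0 then (qPochInf q q)⁻¹ else 0)
    ((summable_geometric_of_lt_one (norm_nonneg q) hq).mul_right (C * C)) (fun m => ?_)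
    (Eventually.of_forall fun l m => norm_pow_mul_rPoch_le hq h0 hC _ _
      (by nlinarith [Nat.le_self_pow two_ne_zero m]) _ _)
  · rwa [tsum_ite_eq] at h
  · rcases m with _ | m
    · have h00 : rPoch q 0 = 1 := by simp [rPoch, qPoch]
      simpa [h00] using tendsto_rPoch hq
    · simp only [Nat.add_eq_zero_iff, one_ne_zero, and_false, if_false]
      refine squeeze_zero_norm (fun l => norm_pow_mul_rPoch_le hq h0 hC l _ (by nlinarith) _ _) ?_
      simpa using (tendsto_pow_atTop_nhds_zero_of_lt_one (norm_nonneg q) hq).mul_const (C * C)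

/-- By `durfee_sub_durfee` the norms of consecutive differences increase with `l`, yet they tend to
0. So all differences vanish and the sum equals its limit. -/
theorem durfee_eq {q : ℂ} (hq : ‖q‖ < 1) (l : ℕ) : durfee q l = (qPochInf q q)⁻¹ := by
  have hmono : Monotone fun l => ‖durfee q l - durfee q (l + 1)‖ := by
    refine monotone_nat_of_le_succ fun l => ?_
    rw [durfee_sub_durfee hq, norm_mul, norm_neg, norm_pow]
    exact mul_le_of_le_one_left (norm_nonneg _) (pow_le_one₀ (norm_nonneg _) hq.le)
  have hlim : Tendsto (fun l => ‖durfee q l - durfee q (l + 1)‖) atTop (𝓝 0) := by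
    simpa using ((tendsto_durfee hq).sub ((tendsto_durfee hq).comp (tendsto_add_atTop_nat 1))).norm
  have hconst : ∀ l, durfee q (l + 1) = durfee q l := fun l =>
    (sub_eq_zero.mp (norm_le_zero_iff.mp (hmono.ge_of_tendsto hlim l))).symm
  have hall : ∀ n, durfee q (n + l) = durfee q l := fun n => by
    induction n with
    | zero => rw [zero_add]
    | succ n ih => rw [← ih, ← hconst (n + l)]; congr 1; ring
  have h := (tendsto_durfee hq).comp (tendsto_add_atTop_nat l)
  exact tendsto_nhds_unique (tendsto_const_nhds.congr fun n => (hall n).symm) h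

theorem hasSum_durfee {q : ℂ} (hq : ‖q‖ < 1) (k : ℤ) :
    HasSum (fun N : ℕ => q ^ N ^ 2 * (rPoch q (N - k) * rPoch q (N + k)))
      (q ^ k.natAbs ^ 2 * (qPochInf q q)⁻¹) := by
  wlog hk : 0 ≤ k generalizing k
  · have h := this (-k) (by omega)
    simpa only [Int.natAbs_neg, sub_neg_eq_add, ← sub_eq_add_neg,
      mul_comm (rPoch q (_ - _))] using h
  lift k to ℕ using hk
  have h := ((summable_durfee hq (2 * k) (2 * k : ℕ)).hasSum).mul_left (q ^ k ^ 2)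
  rw [← durfee, durfee_eq hq] at h
  rw [Int.natAbs_natCast, ← (add_left_injective k).hasSum_iff]
  · refine h.congr_fun fun m => ?_
    simp only [Function.comp_apply]
    push_cast
    rw [add_sub_cancel_right, show (m : ℤ) + k + k = m + 2 * k by ring]
    ring
  · intro N hN
    have : N < k := by
      by_contra h
      exact hN ⟨N - k, by simp; omega⟩
    rw [rPoch_of_neg q (show (N : ℤ) - k < 0 by omega), zero_mul, mul_zero]

/-! ### Bailey's lemma -/

theorem summable_pow_natAbs {ρ : ℝ} (h0 : 0 ≤ ρ) (h1 : ρ < 1) :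
    Summable fun j : ℤ => ρ ^ j.natAbs := by
  have h := summable_geometric_of_lt_one h0 h1
  exact Summable.of_nat_of_neg (by simpa using h) (by simpa using h)

/-- The limiting case of Bailey's lemma relative to `a = 1`, in bilateral form. -/
theorem hasSum_bailey {q : ℂ} (hq : ‖q‖ < 1) {α : ℤ → ℂ} {c : ℤ → ℤ} (hα : ∀ j, ‖α j‖ ≤ 1)
    (hc : ∀ j, j.natAbs ≤ (c j).natAbs) :
    HasSum (fun N : ℕ => q ^ N ^ 2 * ∑' j, α j * (rPoch q (N - c j) * rPoch q (N + c j)))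
      ((qPochInf q q)⁻¹ * ∑' j, q ^ (c j).natAbs ^ 2 * α j) := by
  obtain ⟨C, h0, hC⟩ := exists_norm_rPoch_le hq
  set F : ℕ × ℤ → ℂ := fun p =>
    α p.2 * (q ^ p.1 ^ 2 * (rPoch q (p.1 - c p.2) * rPoch q (p.1 + c p.2))) with hF
  have hρ1 : √‖q‖ < 1 := by rwa [Real.sqrt_lt' one_pos, one_pow]
  have hs : Summable F := by
    refine Summable.of_norm_bounded (((summable_geometric_of_lt_one (Real.sqrt_nonneg _)
      hρ1).mul_of_nonneg (summable_pow_natAbs (Real.sqrt_nonneg _) hρ1)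
        (fun _ => by positivity) (fun _ => by positivity)).mul_right (C * C)) ?_
    rintro ⟨N, j⟩
    simp only [hF]
    by_cases h : (c j).natAbs ≤ N
    · rw [norm_mul]
      refine (mul_le_of_le_one_left (norm_nonneg _) (hα j)).trans
        ((norm_pow_mul_rPoch_le hq h0 hC _ _ le_rfl _ _).trans ?_)
      refine mul_le_mul_of_nonneg_right ?_ (by positivity)
      rw [← pow_add]
      -- The square root doubles the exponent: `|j| ≤ |c j| ≤ N` gives `N + |j| ≤ 2 N^2`, a bound
      -- geometric in both `N` and `j`.
      nth_rewrite 1 [← Real.sq_sqrt (norm_nonneg q)]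
      rw [← pow_mul]
      refine pow_le_pow_of_le_one (Real.sqrt_nonneg _) hρ1.le ?_
      nlinarith [Nat.le_self_pow two_ne_zero N, (hc j).trans h]
    · have : rPoch q (N - c j) * rPoch q (N + c j) = 0 := by
        rcases lt_or_ge (c j) 0 with h' | h'
        · rw [rPoch_of_neg q (show (N : ℤ) + c j < 0 by omega), mul_zero]
        · rw [rPoch_of_neg q (show (N : ℤ) - c j < 0 by omega), zero_mul]
      rw [this, mul_zero, mul_zero, norm_zero]
      positivity
  have h1 := hs.hasSum.prod_fiberwise fun N => (hs.prod_factor N).hasSum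
  have h2 : ∑' p, F p = (qPochInf q q)⁻¹ * ∑' j, q ^ (c j).natAbs ^ 2 * α j := by
    rw [hs.tsum_prod, ← hs.tsum_comm (f := fun N j => F (N, j)), ← tsum_mul_left]
    refine tsum_congr fun j => ?_
    simp only [hF]
    rw [tsum_mul_left, (hasSum_durfee hq (c j)).tsum_eq]
    ring
  rw [h2] at h1
  refine h1.congr_fun fun N => ?_
  simp only [hF]
  rw [← tsum_mul_left]
  exact tsum_congr fun j => by ring

/-! ### Jacobi's triple product -/

/-- The finite form of Jacobi's triple product identity. -/
theorem bisum_jacobi {t z : ℂ} (ht : ‖t ^ 2‖ < 1) (ht0 : t ≠ 0) (hz : z ≠ 0) (N : ℕ) :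
    bisum (t ^ 2) 1 (2 * N) N (fun j => (-1) ^ j * z ^ j * t ^ (j ^ 2 - j)) =
      qPoch z (t ^ 2) N * qPoch (t ^ 2 / z) (t ^ 2) N := by
  have hq0 : t ^ 2 ≠ 0 := pow_ne_zero 2 ht0
  induction N with
  | zero =>
    rw [bisum, tsum_eq_single 0]
    · simp [gbin_zero_zero, qPoch]
    · intro j hj
      rcases lt_or_gt_of_ne hj with h | h
      · rw [gbin_of_neg _ _ (by push_cast; omega), mul_zero]
      · rw [gbin_of_lt _ _ (by push_cast; omega), mul_zero]
  | succ N ih =>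
    -- In each of the two Pascal steps from row `2N` to `2N+2`, one summand is a shifted multiple of
    -- the other. This step yields the factor `1 - z t^{2N}`, and `h2` yields `1 - t^{2N+2} / z`.
    have h1 : bisum (t ^ 2) 1 (2 * N + 1) N
        (fun j => (t ^ 2) ^ ((2 * N + 1 : ℕ) + 1 - ((N + 1 : ℕ) + 1 * j) : ℤ) *
          ((-1) ^ j * z ^ j * t ^ (j ^ 2 - j))) = -(z * (t ^ 2) ^ N) *
        bisum (t ^ 2) 1 (2 * N + 1) (N + 1) (fun j => (-1) ^ j * z ^ j * t ^ (j ^ 2 - j)) := by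
      rw [bisum_shift, ← bisum_const_mul]
      congr 1
      funext j
      rw [zpow_add_one₀ (by norm_num), zpow_add_one₀ hz, ← pow_mul, ← zpow_natCast t 2,
        ← zpow_natCast t (2 * N), ← zpow_mul]
      have : t ^ (((2 : ℕ) : ℤ) * ((2 * N + 1 : ℕ) + 1 - ((N + 1 : ℕ) + 1 * (j + 1)))) *
          t ^ ((j + 1) ^ 2 - (j + 1)) = t ^ ((2 * N : ℕ) : ℤ) * t ^ (j ^ 2 - j) := by
        rw [← zpow_add₀ ht0, ← zpow_add₀ ht0]
        congr 1; push_cast; ring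
      linear_combination (-((-1) ^ j * z ^ j * z)) * this
    have h2 : bisum (t ^ 2) 1 (2 * N) (N + 1)
        (fun j => (t ^ 2) ^ ((N + 1 : ℤ) + 1 * j) * ((-1) ^ j * z ^ j * t ^ (j ^ 2 - j))) =
        -(t ^ 2 / z * (t ^ 2) ^ N) *
        bisum (t ^ 2) 1 (2 * N) N (fun j => (-1) ^ j * z ^ j * t ^ (j ^ 2 - j)) := by
      rw [bisum_shift _ _ _ (N : ℤ), ← bisum_const_mul]
      congr 1
      funext j
      rw [zpow_add_one₀ (by norm_num), zpow_add_one₀ hz, div_mul_eq_mul_div, ← pow_succ', ← pow_mul,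
        ← zpow_natCast t 2, ← zpow_natCast t (2 * (N + 1)), ← zpow_mul]
      have : t ^ (((2 : ℕ) : ℤ) * ((N + 1 : ℤ) + 1 * j)) * t ^ (j ^ 2 - j) =
          t ^ ((2 * (N + 1) : ℕ) : ℤ) * t ^ ((j + 1) ^ 2 - (j + 1)) := by
        rw [← zpow_add₀ ht0, ← zpow_add₀ ht0]
        congr 1; push_cast; ring
      field_simp
      linear_combination this
    rw [show 2 * (N + 1) = 2 * N + 1 + 1 by ring, bisum_succ' ht hq0 one_ne_zero,
      show ((N + 1 : ℕ) : ℤ) - 1 = N by push_cast; ring, h1,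
      show ((N + 1 : ℕ) : ℤ) = N + 1 by push_cast; ring, bisum_succ ht hq0 one_ne_zero,
      add_sub_cancel_right, h2, ih]
    simp only [qPoch, Finset.prod_range_succ]
    ring

/-- Jacobi's triple product identity. -/
theorem tsum_jacobi {t z : ℂ} (ht : ‖t ^ 2‖ < 1) (ht0 : t ≠ 0) (hz : z ≠ 0)
    (h : Summable fun j : ℤ => (-1) ^ j * z ^ j * t ^ (j ^ 2 - j)) :
    ∑' j : ℤ, (-1) ^ j * z ^ j * t ^ (j ^ 2 - j) =
      qPochInf₃ z (t ^ 2 / z) (t ^ 2) (t ^ 2) := by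
  obtain ⟨C, h0, hC⟩ := exists_norm_rPoch_le ht
  obtain ⟨B, hB⟩ := exists_norm_qPoch_le ht
  have hB0 : 0 ≤ B := (norm_nonneg _).trans (hB 0)
  have hP := qPochInf_ne_zero ht
  set P := qPochInf (t ^ 2) (t ^ 2) with hPdef
  have h1 := tendsto_tsum_of_dominated_convergence (𝓕 := atTop)
    (f := fun (N : ℕ) (j : ℤ) => (-1) ^ j * z ^ j * t ^ (j ^ 2 - j) *
      gbin (t ^ 2) (2 * N) (N + 1 * j))
    (g := fun j : ℤ => (-1) ^ j * z ^ j * t ^ (j ^ 2 - j) * (P * P⁻¹ * P⁻¹))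
    (h.norm.mul_right (B * C * C)) (fun j => ?_) (Eventually.of_forall fun N j => ?_)
  · have h2 := (tendsto_qPoch z ht).mul (tendsto_qPoch (t ^ 2 / z) ht)
    simp only [← bisum_jacobi ht ht0 hz] at h2
    have h3 := tendsto_nhds_unique h1 h2
    rw [tsum_mul_right] at h3
    rw [qPochInf₃, ← h3, ← hPdef]
    field_simp
  · have hadd : ∀ k : ℤ, Tendsto (fun N : ℕ => rPoch (t ^ 2) (N + k)) atTop (𝓝 P⁻¹) := fun k => by
      have h3 : Tendsto (fun N : ℕ => ((N : ℤ) + k).toNat) atTop atTop :=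
        tendsto_atTop.mpr fun b => (eventually_ge_atTop (b + k.natAbs)).mono fun N hN => by omega
      refine ((tendsto_rPoch ht).comp h3).congr' ?_
      filter_upwards [eventually_ge_atTop k.natAbs] with N hN
      simp only [Function.comp_apply]
      rw [Int.toNat_of_nonneg (by omega)]
    have h4 : Tendsto (fun N : ℕ => qPoch (t ^ 2) (t ^ 2) (2 * N)) atTop (𝓝 P) :=
      (tendsto_qPoch _ ht).comp (tendsto_id.const_mul_atTop' two_pos)
    refine (((h4.mul (hadd j)).mul (hadd (-j))).congr fun N => ?_).const_mul _
    rw [gbin, one_mul, show ((2 * N : ℕ) : ℤ) - (N + j) = N + -j by push_cast; ring]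
  · rw [norm_mul]
    refine mul_le_mul_of_nonneg_left ?_ (norm_nonneg _)
    rw [gbin, norm_mul, norm_mul]
    have := hB (2 * N)
    have := hC (N + 1 * j)
    have := hC ((2 * N : ℕ) - (N + 1 * j))
    gcongr

theorem norm_zpow_le_pow_natAbs {s : ℂ} (hs : ‖s‖ < 1) {e : ℤ} (j : ℤ) (he : j.natAbs ≤ e) :
    ‖s ^ e‖ ≤ ‖s‖ ^ j.natAbs := by
  lift e to ℕ using by omega
  rw [zpow_natCast, norm_pow]
  exact pow_le_pow_of_le_one (norm_nonneg _) hs.le (by omega)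

theorem norm_neg_one_zpow_mul (j : ℤ) (x : ℂ) : ‖(-1) ^ j * x‖ = ‖x‖ := by
  rw [norm_mul, norm_zpow, norm_neg, norm_one, one_zpow, one_mul]

theorem tsum_jacobi_thirteen {s : ℂ} (hs : ‖s‖ < 1) (hs0 : s ≠ 0) {i k : ℕ} (hik : i + k = 13)
    (hi : 0 < i) (hk : 0 < k) :
    ∑' j : ℤ, (-1) ^ j * s ^ (13 * j ^ 2 + (k - i) * j) =
      qPochInf₃ ((s ^ 2) ^ i) ((s ^ 2) ^ k) ((s ^ 2) ^ 13) ((s ^ 2) ^ 13) := by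
  have ht : (s ^ 13) ^ 2 = (s ^ 2) ^ 13 := by ring
  have ht1 : ‖(s ^ 13) ^ 2‖ < 1 := by
    rw [← pow_mul, norm_pow]; exact pow_lt_one₀ (norm_nonneg _) hs (by norm_num)
  -- With `t = s^13`, `z = s^{2i}` Jacobi's exponent is `13(j^2 - j) + 2ij = 13j^2 - (k - i)j`, so
  -- `j` is negated.
  have e : ∀ j : ℤ, (-1) ^ j * ((s ^ 2) ^ i) ^ (-j) * (s ^ 13) ^ ((-j) ^ 2 - (-j)) =
      (-1) ^ j * s ^ (13 * j ^ 2 + (k - i) * j) := fun j => by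
    rw [mul_assoc, ← pow_mul, ← zpow_natCast, ← zpow_natCast s 13, ← zpow_mul, ← zpow_mul,
      ← zpow_add₀ hs0]
    congr 2
    obtain rfl : i = 13 - k := by omega
    push_cast [show k ≤ 13 by omega]
    ring
  have hsum : Summable fun j : ℤ => (-1) ^ j * s ^ (13 * j ^ 2 + (k - i) * j) := by
    refine Summable.of_norm_bounded (summable_pow_natAbs (norm_nonneg s) hs) fun j => ?_
    rw [norm_neg_one_zpow_mul]
    refine norm_zpow_le_pow_natAbs hs j ?_
    have h1 : |(k - i : ℤ)| ≤ 12 := by rw [abs_le]; omega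
    have h2 : |(k - i : ℤ) * j| ≤ 12 * |j| := by
      rw [abs_mul]; exact mul_le_mul_of_nonneg_right h1 (abs_nonneg _)
    have h3 : |j| ≤ j ^ 2 := by rw [← sq_abs]; exact Int.le_self_sq _
    rw [Int.natCast_natAbs]
    linarith [neg_abs_le ((k - i : ℤ) * j)]
  have hn : ∀ j : ℤ, ((-1 : ℂ)) ^ (-j) = (-1) ^ j := fun j => by
    rw [zpow_neg, ← inv_zpow, inv_neg, inv_one]
  have hneg : ∀ j : ℤ, (-1) ^ j * s ^ (13 * j ^ 2 + (k - i) * j) =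
      (fun j : ℤ => (-1) ^ j * ((s ^ 2) ^ i) ^ j * (s ^ 13) ^ (j ^ 2 - j)) (Equiv.neg ℤ j) :=
    fun j => by
      rw [← e]
      simp only [Equiv.neg_apply, hn]
  rw [tsum_congr hneg, (Equiv.neg ℤ).tsum_eq
    (fun j : ℤ => (-1) ^ j * ((s ^ 2) ^ i) ^ j * (s ^ 13) ^ (j ^ 2 - j)), tsum_jacobi ht1 (pow_ne_zero _ hs0)
    (pow_ne_zero _ (pow_ne_zero _ hs0)), ht]
  · congr 1
    rw [← hik, pow_add, mul_div_cancel_left₀ _ (pow_ne_zero _ (pow_ne_zero _ hs0))]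
  · rw [← (Equiv.neg ℤ).summable_iff]
    exact hsum.congr hneg

/-! ### From alternating sums to the modulus 13 products -/

theorem norm_sq_lt_one {s : ℂ} (hs : ‖s‖ < 1) : ‖s ^ 2‖ < 1 := by
  rw [norm_pow]; exact pow_lt_one₀ (norm_nonneg _) hs two_ne_zero

theorem pow_natAbs_sq (s : ℂ) (c : ℤ) : (s ^ 2) ^ c.natAbs ^ 2 = s ^ (2 * c ^ 2) := by
  rw [← pow_mul, ← zpow_natCast]
  congr 1
  push_cast
  rw [sq_abs]

theorem gbin_two_mul_div {q : ℂ} (hq : ‖q‖ < 1) (N : ℕ) (k : ℤ) :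
    gbin q (2 * N) (N + k) / qPoch q q (2 * N) = rPoch q (N - k) * rPoch q (N + k) := by
  have := qPoch_ne_zero hq (2 * N)
  rw [gbin, show ((2 * N : ℕ) : ℤ) - (N + k) = N - k by push_cast; ring]
  field_simp

/-- The exponent `5j^2 + aj` is nonnegative at every integer because `|a| ≤ 5`. -/
theorem norm_neg_one_zpow_mul_le {s : ℂ} (hs : ‖s‖ < 1) {a : ℤ} (ha : |a| ≤ 5) (j : ℤ) :
    ‖(-1) ^ j * s ^ (j * (5 * j + a))‖ ≤ 1 := by
  rw [norm_neg_one_zpow_mul]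
  refine (norm_zpow_le_pow_natAbs hs 0 ?_).trans_eq (pow_zero _)
  have h2 : |a * j| ≤ 5 * |j| := by
    rw [abs_mul]; exact mul_le_mul_of_nonneg_right ha (abs_nonneg _)
  have h3 : |j| ≤ j ^ 2 := by rw [← sq_abs]; exact Int.le_self_sq _
  simp only [Int.natAbs_zero, Nat.cast_zero]
  linarith [neg_abs_le (a * j)]

theorem hasSum_gsum_even {s : ℂ} (hs : ‖s‖ < 1) (hs0 : s ≠ 0) {i k : ℕ} (hik : i + k = 13)
    (hi : 3 < i) (hk : 3 < k) :
    HasSum (fun N : ℕ => (s ^ 2) ^ N ^ 2 *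
        (gsum s (2 * N) N (k - i) / qPoch (s ^ 2) (s ^ 2) (2 * N)))
      (qPochInf₃ ((s ^ 2) ^ i) ((s ^ 2) ^ k) ((s ^ 2) ^ 13) ((s ^ 2) ^ 13) /
        qPochInf (s ^ 2) (s ^ 2)) := by
  have hq := norm_sq_lt_one hs
  have ha : |(k - i : ℤ)| ≤ 5 := by rw [abs_le]; omega
  have h := hasSum_bailey hq (c := fun j => 2 * j) (norm_neg_one_zpow_mul_le hs ha)
    fun j => by omega
  rw [← tsum_jacobi_thirteen hs hs0 hik (by omega) (by omega), div_eq_inv_mul]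
  rw [tsum_congr (g := fun j : ℤ => (-1) ^ j * s ^ (13 * j ^ 2 + (k - i) * j)) fun j => by
    rw [pow_natAbs_sq, mul_left_comm, ← zpow_add₀ hs0]
    congr 2; ring] at h
  refine h.congr_fun fun N => congrArg _ ?_
  rw [gsum, bisum, ← tsum_div_const]
  exact tsum_congr fun j => by rw [mul_div_assoc, gbin_two_mul_div hq]

/-- Here `c_j = 2j+1`, and `q^{c_j^2} = s^{8j^2+8j+2}` adds 8 to the linear coefficient, hence the
`- 8`, and contributes an extra factor `q`. -/
theorem hasSum_gsum_odd {s : ℂ} (hs : ‖s‖ < 1) (hs0 : s ≠ 0) {i k : ℕ} (hik : i + k = 13)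
    (hi : 0 < i) (hi' : i < 6) :
    HasSum (fun N : ℕ => (s ^ 2) ^ (N ^ 2 + 2 * N) *
        (gsum s (2 * (N + 1)) ((N + 1 : ℕ) + 1) (k - i - 8) /
          qPoch (s ^ 2) (s ^ 2) (2 * (N + 1))))
      (qPochInf₃ ((s ^ 2) ^ i) ((s ^ 2) ^ k) ((s ^ 2) ^ 13) ((s ^ 2) ^ 13) /
        qPochInf (s ^ 2) (s ^ 2)) := by
  have hq := norm_sq_lt_one hs
  have hq0 : s ^ 2 ≠ 0 := pow_ne_zero 2 hs0
  have ha : |(k - i - 8 : ℤ)| ≤ 5 := by rw [abs_le]; omega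
  have h : HasSum (fun N : ℕ => (s ^ 2) ^ N ^ 2 *
      (gsum s (2 * N) (N + 1) (k - i - 8) / qPoch (s ^ 2) (s ^ 2) (2 * N)))
      (s ^ 2 * (qPochInf₃ ((s ^ 2) ^ i) ((s ^ 2) ^ k) ((s ^ 2) ^ 13) ((s ^ 2) ^ 13) /
        qPochInf (s ^ 2) (s ^ 2))) := by
    have h := hasSum_bailey hq (c := fun j => 2 * j + 1) (norm_neg_one_zpow_mul_le hs ha)
      fun j => by omega
    rw [← tsum_jacobi_thirteen hs hs0 hik (by omega) (by omega), div_eq_inv_mul, mul_left_comm,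
      ← tsum_mul_left]
    rw [tsum_congr (g := fun j : ℤ => s ^ 2 * ((-1) ^ j * s ^ (13 * j ^ 2 + (k - i) * j)))
      fun j => by
        rw [pow_natAbs_sq, mul_left_comm, ← zpow_add₀ hs0, mul_left_comm (s ^ 2),
          ← zpow_natCast s 2, ← zpow_add₀ hs0]
        congr 2; push_cast; ring] at h
    refine h.congr_fun fun N => congrArg _ ?_
    rw [gsum, bisum, ← tsum_div_const]
    exact tsum_congr fun j => by
      rw [mul_div_assoc, show (N + 1 + 2 * j : ℤ) = N + (2 * j + 1) by ring, gbin_two_mul_div hq]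
  -- The term `N = 0` vanishes, so the series starts at `N + 1`; dividing by `q` leaves `q^{(N+1)^2
  -- - 1} = q^{N^2+2N}`.
  have h' := ((hasSum_nat_add_iff' 1).mpr h).mul_left (s ^ 2)⁻¹
  simp only [Finset.range_one, Finset.sum_singleton, Nat.cast_zero, mul_zero, zero_add,
    gsum_odd_zero, zero_div, sub_zero, inv_mul_cancel_left₀ hq0] at h'
  refine h'.congr_fun fun N => ?_
  rw [← mul_assoc, show (N + 1) ^ 2 = N ^ 2 + 2 * N + 1 by ring, pow_succ' (s ^ 2),
    inv_mul_cancel_left₀ hq0]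

/-! ### Antidiagonal sums and double series -/

theorem rsum_eq_sum_antidiagonal {q : ℂ} (hq0 : q ≠ 0) (k : ℤ) (N : ℕ) :
    rsum q k N = ∑ p ∈ Finset.HasAntidiagonal.antidiagonal N,
      q ^ p.2 ^ 2 * gbin q N p.2 * (q ^ p.2) ^ k := by
  have h : ∀ j ∉ (Finset.range (N + 1)).map Nat.castEmbedding,
      q ^ (j ^ 2 + k * j) * gbin q N (0 + 1 * j) = 0 := fun j hj => by
    rcases lt_or_ge j 0 with h | h
    · rw [gbin_of_neg _ _ (by omega), mul_zero]
    · lift j to ℕ using h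
      have : N < j := by simpa using hj
      rw [gbin_of_lt _ _ (by omega), mul_zero]
  rw [rsum, bisum, tsum_eq_sum h, Finset.sum_map,
    ← Finset.Nat.sum_antidiagonal_swap, Finset.Nat.sum_antidiagonal_eq_sum_range_succ_mk]
  refine Finset.sum_congr rfl fun r _ => ?_
  simp only [Nat.castEmbedding_apply, Prod.snd_swap, zero_add, one_mul]
  rw [zpow_add₀ hq0, mul_comm k, zpow_mul, zpow_natCast, ← Nat.cast_pow, zpow_natCast]
  ring

theorem gbin_add {q : ℂ} (n r : ℕ) :
    gbin q (n + r) r = qPoch q q (n + r) / (qPoch q q r * qPoch q q n) := by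
  rw [gbin, rPoch_natCast, show ((n + r : ℕ) : ℤ) - r = n by push_cast; ring, rPoch_natCast]
  ring

/-- Summation of a double series along the antidiagonals. -/
theorem hasSum_of_antidiagonal {q : ℂ} (hq : ‖q‖ < 1) {u : ℕ → ℂ} (hu : ∃ U, ∀ N, ‖u N‖ ≤ U)
    {w : ℂ × ℂ → ℂ} (hw : Continuous w) {S : ℂ}
    (h : HasSum (fun N => q ^ N ^ 2 * (u N * ∑ p ∈ Finset.HasAntidiagonal.antidiagonal N,
      q ^ p.2 ^ 2 * gbin q N p.2 * w (q ^ p.1, q ^ p.2))) S) :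
    HasSum (fun p : ℕ × ℕ => q ^ (p.1 + p.2) ^ 2 * (u (p.1 + p.2) *
      (q ^ p.2 ^ 2 * gbin q (p.1 + p.2) p.2 * w (q ^ p.1, q ^ p.2)))) S := by
  obtain ⟨U, hU⟩ := hu
  obtain ⟨C, hC0, hC⟩ := exists_norm_rPoch_le hq
  obtain ⟨B, hB⟩ := exists_norm_qPoch_le hq
  obtain ⟨W, hW⟩ := ((isCompact_closedBall (0 : ℂ) 1).prod
    (isCompact_closedBall (0 : ℂ) 1)).exists_bound_of_continuousOn hw.continuousOn
  have hU0 : 0 ≤ U := (norm_nonneg _).trans (hU 0)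
  have hB0 : 0 ≤ B := (norm_nonneg _).trans (hB 0)
  have hpow : ∀ n : ℕ, ‖q ^ n‖ ≤ 1 := fun n => by
    rw [norm_pow]; exact pow_le_one₀ (norm_nonneg _) hq.le
  have hgeo := summable_geometric_of_lt_one (norm_nonneg q) hq
  have hs : Summable fun p : ℕ × ℕ => q ^ (p.1 + p.2) ^ 2 * (u (p.1 + p.2) *
      (q ^ p.2 ^ 2 * gbin q (p.1 + p.2) p.2 * w (q ^ p.1, q ^ p.2))) := by
    -- The weight is continuous, hence bounded on the closed unit bidisc containing all `(q^n,
    -- q^r)`. The decay comes from `q^{(n+r)^2}` alone.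
    refine Summable.of_norm_bounded ((hgeo.mul_of_nonneg hgeo (fun _ => by positivity)
      (fun _ => by positivity)).mul_right (U * (1 * (B * C * C) * W))) ?_
    rintro ⟨n, r⟩
    have h1 : ‖q ^ (n + r) ^ 2‖ ≤ ‖q‖ ^ n * ‖q‖ ^ r := by
      rw [← pow_add, norm_pow]
      exact pow_le_pow_of_le_one (norm_nonneg _) hq.le (Nat.le_self_pow two_ne_zero _)
    have h2 := hU (n + r)
    have h3 := hpow (r ^ 2)
    have h4 : ‖gbin q (n + r) r‖ ≤ B * C * C := by
      rw [gbin, norm_mul, norm_mul]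
      have := hB (n + r)
      have := hC r
      have := hC ((n + r : ℕ) - r)
      gcongr
    have h5 := hW (q ^ n, q ^ r) (by
      simpa only [Set.mem_prod, mem_closedBall_zero_iff] using ⟨hpow n, hpow r⟩)
    simp only [norm_mul] at h1 h3 ⊢
    gcongr
  have h0 := (Finset.HasAntidiagonal.sigmaAntidiagonalEquivProd (A := ℕ)).hasSum_iff.mpr hs.hasSum
  have h1 := h0.sigma (g := fun N => q ^ N ^ 2 * (u N *
    ∑ p ∈ Finset.HasAntidiagonal.antidiagonal N,
      q ^ p.2 ^ 2 * gbin q N p.2 * w (q ^ p.1, q ^ p.2))) fun N => ?_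
  · rw [← h1.unique h]
    exact hs.hasSum
  · rw [Finset.mul_sum, Finset.mul_sum]
    refine (Finset.hasSum _ _).congr_fun fun p => ?_
    have hp := Finset.HasAntidiagonal.mem_antidiagonal.mp p.2
    simp only [Function.comp_apply, Finset.HasAntidiagonal.sigmaAntidiagonalEquivProd_apply, hp]

/-! ### The alternating sums in the form of the six weights -/

open Finset.HasAntidiagonal

/-- The factor `1 - q^{N+1}` extracted here and in the next two lemmas turns `(q)_N` into the
`(q)_{n+r+1}` of the first three identities. -/
theorem gsum_odd_succ_three {s : ℂ} (hs : ‖s ^ 2‖ < 1) (hs0 : s ≠ 0) (N : ℕ) :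
    gsum s (2 * (N + 1)) ((N + 1 : ℕ) + 1) 3 =
      (1 - (s ^ 2) ^ (N + 1)) * rsum (s ^ 2) 1 N := by
  have d := rsum_sub_rsum hs (pow_ne_zero 2 hs0) (-1) N
  norm_num at d
  rw [gsum_odd_three hs hs0, d]

theorem gsum_odd_succ_one {s : ℂ} (hs : ‖s ^ 2‖ < 1) (hs0 : s ≠ 0) (N : ℕ) :
    gsum s (2 * (N + 1)) ((N + 1 : ℕ) + 1) 1 = (1 - (s ^ 2) ^ (N + 1)) *
      (rsum (s ^ 2) 1 N + s ^ 2 * rsum (s ^ 2) 2 N + (s ^ 2) ^ (N + 1) * rsum (s ^ 2) 0 N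
        - (s ^ 2) ^ (N + 1) * rsum (s ^ 2) 1 N) := by
  have hq0 : s ^ 2 ≠ 0 := pow_ne_zero 2 hs0
  have d := rsum_sub_rsum hs hq0 (-1) N
  have r0 := rsum_succ hs hq0 0 N
  have r1 := rsum_succ' hs hq0 1 N
  have c0 := rsum_contiguous hs hq0 0 N
  rw [show (N + 1 + 1 : ℤ) = (N + 2 : ℕ) by push_cast; ring, zpow_natCast] at r1
  rw [show (N + 1 + 0 : ℤ) = (N + 1 : ℕ) by push_cast; ring, zpow_natCast] at c0
  norm_num at d r0 r1 c0
  rw [gsum_odd_one hs hs0, gsum_even_three hs hs0, d, r0, r1, c0]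
  ring

theorem gsum_odd_succ_neg_one {s : ℂ} (hs : ‖s ^ 2‖ < 1) (hs0 : s ≠ 0) (N : ℕ) :
    gsum s (2 * (N + 1)) ((N + 1 : ℕ) + 1) (-1) = (1 - (s ^ 2) ^ (N + 1)) *
      ((1 - (s ^ 2) ^ (N + 1)) * (1 + s ^ 2) * (rsum (s ^ 2) 2 N + (s ^ 2) ^ N * rsum (s ^ 2) 0 N)
        - (s ^ 2) ^ N * rsum (s ^ 2) 1 N + (s ^ 2) ^ 2 * rsum (s ^ 2) 3 N
        + (s ^ 2) ^ (2 * N + 2) * rsum (s ^ 2) (-1) N + (s ^ 2) ^ (2 * N + 1) * rsum (s ^ 2) 1 N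
        + (s ^ 2) ^ (N + 2) * rsum (s ^ 2) 1 N) := by
  have hq0 : s ^ 2 ≠ 0 := pow_ne_zero 2 hs0
  have e5 := mul_gsum_even_five hs hs0 (N + 1)
  have r0 := rsum_succ hs hq0 0 N
  have c0 := rsum_contiguous hs hq0 0 N
  have c1 := rsum_contiguous hs hq0 1 N
  have cm := rsum_contiguous hs hq0 (-1) N
  rw [show (N + 1 + 0 : ℤ) = (N + 1 : ℕ) by push_cast; ring, zpow_natCast] at c0
  rw [show (N + 1 + 1 : ℤ) = (N + 2 : ℕ) by push_cast; ring, zpow_natCast, one_add_one_eq_two,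
    zpow_ofNat] at c1
  rw [show (N + 1 + -1 : ℤ) = N by ring, zpow_natCast] at cm
  norm_num at r0 c0 c1 cm
  have c1' : (s ^ 2) ^ 2 * rsum (s ^ 2) 3 N =
      rsum (s ^ 2) 1 N - (1 - (s ^ 2) ^ (N + 2)) * rsum (s ^ 2) 2 N := by
    linear_combination -c1
  -- The sum with `a = 5` is known only through its multiple by `q` (`mul_gsum_even_five`).
  refine mul_left_cancel₀ hq0 ?_
  rw [gsum_odd_neg_one hs hs0, mul_sub, mul_left_comm (s ^ 2) (_ ^ (N + 1)) (gsum s _ _ 5), e5,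
    gsum_odd_succ_three hs hs0, gsum_odd_succ_one hs hs0, r0, c1', cm, c0]
  ring

theorem mul_gsum_even_five_eq {s : ℂ} (hs : ‖s ^ 2‖ < 1) (hs0 : s ≠ 0) (N : ℕ) :
    s ^ 2 * gsum s (2 * N) N 5 = rsum (s ^ 2) 1 N - rsum (s ^ 2) 0 N + s ^ 2 * rsum (s ^ 2) 2 N
      + (s ^ 2) ^ (N + 1) * rsum (s ^ 2) 0 N - (s ^ 2) ^ N * rsum (s ^ 2) 1 N
      + (s ^ 2) ^ N * rsum (s ^ 2) (-1) N + (s ^ 2) ^ (2 * N + 1) * rsum (s ^ 2) (-2) N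
      - (s ^ 2) ^ (2 * N) * rsum (s ^ 2) (-1) N - (s ^ 2) ^ (N + 1) * rsum (s ^ 2) 1 N
      - (s ^ 2) ^ (2 * N + 1) * rsum (s ^ 2) (-1) N + (s ^ 2) ^ (2 * N) * rsum (s ^ 2) 0 N := by
  have hq0 : s ^ 2 ≠ 0 := pow_ne_zero 2 hs0
  have c0 := rsum_contiguous hs hq0 0 N
  have cm := rsum_contiguous hs hq0 (-1) N
  have cm2 := rsum_contiguous hs hq0 (-2) N
  rw [show (N + 1 + 0 : ℤ) = (N + 1 : ℕ) by push_cast; ring, zpow_natCast] at c0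
  rw [show (N + 1 + -1 : ℤ) = N by ring, zpow_natCast] at cm
  rw [show (N + 1 + -2 : ℤ) = N - 1 by ring, zpow_sub₀ hq0, zpow_natCast] at cm2
  norm_num at c0 cm cm2
  have cm2' : s ^ 2 * rsum (s ^ 2) (-2) N =
      (s ^ 2 - (s ^ 2) ^ N) * rsum (s ^ 2) (-1) N + rsum (s ^ 2) 0 N := by
    rw [cm2]
    field_simp
  rw [mul_gsum_even_five hs hs0, gsum_odd_one hs hs0, gsum_even_three hs hs0, pow_succ _ (2 * N),
    mul_assoc _ (s ^ 2) (rsum (s ^ 2) (-2) N), cm2', cm, c0]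
  ring

theorem exists_norm_inv_qPoch_le {q : ℂ} (hq : ‖q‖ < 1) :
    ∃ U, ∀ N : ℕ, ‖(qPoch q q (2 * N))⁻¹‖ ≤ U := by
  obtain ⟨C, -, hC⟩ := exists_norm_rPoch_le hq
  exact ⟨C, fun N => by simpa only [rPoch_natCast] using hC (2 * N : ℕ)⟩

theorem exists_norm_shifted_inv_qPoch_le {q : ℂ} (hq : ‖q‖ < 1) :
    ∃ U, ∀ N : ℕ, ‖q ^ (2 * N) * (1 - q ^ (N + 1)) * (qPoch q q (2 * (N + 1)))⁻¹‖ ≤ U := by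
  obtain ⟨C, hC0, hC⟩ := exists_norm_rPoch_le hq
  refine ⟨1 * 2 * C, fun N => ?_⟩
  have hpow : ∀ n : ℕ, ‖q ^ n‖ ≤ 1 := fun n => by
    rw [norm_pow]; exact pow_le_one₀ (norm_nonneg _) hq.le
  have h1 := hpow (2 * N)
  have h2 : ‖1 - q ^ (N + 1)‖ ≤ 2 := (norm_sub_le _ _).trans (by
    rw [norm_one]; linarith [hpow (N + 1)])
  have h3 := hC (2 * (N + 1) : ℕ)
  rw [rPoch_natCast] at h3
  rw [norm_mul, norm_mul]
  gcongr

/-- Double sums whose inner sums are the even alternating sums. -/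
theorem hasSum_double_even {s : ℂ} (hs : ‖s‖ < 1) (hs0 : s ≠ 0) {i k : ℕ} (hik : i + k = 13)
    (hi : 3 < i) (hk : 3 < k) {w : ℂ × ℂ → ℂ} (hw : Continuous w) {x : ℂ}
    (h : ∀ N : ℕ, ∑ p ∈ antidiagonal N,
      (s ^ 2) ^ p.2 ^ 2 * gbin (s ^ 2) N p.2 * w ((s ^ 2) ^ p.1, (s ^ 2) ^ p.2) =
        x * gsum s (2 * N) N (k - i)) :
    HasSum (fun p : ℕ × ℕ => (s ^ 2) ^ (p.1 ^ 2 + 2 * p.2 ^ 2 + 2 * p.1 * p.2) *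
        qPoch (s ^ 2) (s ^ 2) (p.1 + p.2) / (qPoch (s ^ 2) (s ^ 2) (2 * p.1 + 2 * p.2) *
          qPoch (s ^ 2) (s ^ 2) p.2 * qPoch (s ^ 2) (s ^ 2) p.1) *
        w ((s ^ 2) ^ p.1, (s ^ 2) ^ p.2))
      (x * (qPochInf₃ ((s ^ 2) ^ i) ((s ^ 2) ^ k) ((s ^ 2) ^ 13) ((s ^ 2) ^ 13) /
        qPochInf (s ^ 2) (s ^ 2))) := by
  have h1 := (hasSum_gsum_even hs hs0 hik hi hk).mul_left x
  refine (hasSum_of_antidiagonal (norm_sq_lt_one hs)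
    (exists_norm_inv_qPoch_le (norm_sq_lt_one hs)) hw (h1.congr_fun fun N => ?_)).congr_fun
      fun p => ?_
  · rw [h N]
    ring
  · rw [gbin_add, show (p.1 ^ 2 + 2 * p.2 ^ 2 + 2 * p.1 * p.2) = (p.1 + p.2) ^ 2 + p.2 ^ 2 by ring,
      pow_add, ← mul_add 2]
    ring

/-- Double sums whose inner sums are the odd alternating sums. -/
theorem hasSum_double_odd {s : ℂ} (hs : ‖s‖ < 1) (hs0 : s ≠ 0) {i k : ℕ} (hik : i + k = 13)
    (hi : 0 < i) (hi' : i < 6) {w : ℂ × ℂ → ℂ} (hw : Continuous w)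
    (h : ∀ N : ℕ, (1 - (s ^ 2) ^ (N + 1)) * ∑ p ∈ antidiagonal N,
      (s ^ 2) ^ p.2 ^ 2 * gbin (s ^ 2) N p.2 * ((s ^ 2) ^ p.2 * w ((s ^ 2) ^ p.1, (s ^ 2) ^ p.2)) =
        gsum s (2 * (N + 1)) ((N + 1 : ℕ) + 1) (k - i - 8)) :
    HasSum (fun p : ℕ × ℕ => (s ^ 2) ^ (p.1 ^ 2 + 2 * p.2 ^ 2 + 2 * p.1 * p.2 + 2 * p.1 + 3 * p.2) *
        qPoch (s ^ 2) (s ^ 2) (p.1 + p.2 + 1) / (qPoch (s ^ 2) (s ^ 2) (2 * p.1 + 2 * p.2 + 2) *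
          qPoch (s ^ 2) (s ^ 2) p.2 * qPoch (s ^ 2) (s ^ 2) p.1) *
        w ((s ^ 2) ^ p.1, (s ^ 2) ^ p.2))
      (qPochInf₃ ((s ^ 2) ^ i) ((s ^ 2) ^ k) ((s ^ 2) ^ 13) ((s ^ 2) ^ 13) /
        qPochInf (s ^ 2) (s ^ 2)) := by
  have h1 := hasSum_gsum_odd hs hs0 hik hi hi'
  have hw' : Continuous fun z : ℂ × ℂ => z.2 * w z := continuous_snd.mul hw
  refine (hasSum_of_antidiagonal (norm_sq_lt_one hs)
    (exists_norm_shifted_inv_qPoch_le (norm_sq_lt_one hs)) hw' (h1.congr_fun fun N => ?_)).congr_fun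
      fun p => ?_
  · rw [← h N]
    ring
  · rw [gbin_add, qPoch_succ, show 2 * p.1 + 2 * p.2 + 2 = 2 * (p.1 + p.2 + 1) by ring]
    ring

/-- A weighted sum over an antidiagonal as a combination of the sums `rsum`. -/
theorem sum_antidiagonal_eq {q : ℂ} (hq0 : q ≠ 0) {w : ℂ × ℂ → ℂ} {N : ℕ} (a b c d e f : ℂ)
    (h : ∀ n r, n + r = N → w (q ^ n, q ^ r) = a * ((q ^ r) ^ 2)⁻¹ + b * (q ^ r)⁻¹ + c +
      d * q ^ r + e * (q ^ r) ^ 2 + f * (q ^ r) ^ 3) :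
    ∑ p ∈ antidiagonal N, q ^ p.2 ^ 2 * gbin q N p.2 * w (q ^ p.1, q ^ p.2) =
      a * rsum q (-2) N + b * rsum q (-1) N + c * rsum q 0 N + d * rsum q 1 N +
        e * rsum q 2 N + f * rsum q 3 N := by
  simp only [rsum_eq_sum_antidiagonal hq0, Finset.mul_sum, ← Finset.sum_add_distrib]
  refine Finset.sum_congr rfl fun p hp => ?_
  rw [h p.1 p.2 (mem_antidiagonal.mp hp), zpow_neg, zpow_neg_one, zpow_zero, zpow_one,
    zpow_ofNat, zpow_ofNat]
  ring

/-! ### The six double series for nonzero `q` -/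

theorem hasSum_double_one {s : ℂ} (hs : ‖s‖ < 1) (hs0 : s ≠ 0) :
    HasSum (fun p : ℕ × ℕ => (s ^ 2) ^ (p.1 ^ 2 + 2 * p.2 ^ 2 + 2 * p.1 * p.2 + 2 * p.1 + 3 * p.2) *
        qPoch (s ^ 2) (s ^ 2) (p.1 + p.2 + 1) / (qPoch (s ^ 2) (s ^ 2) (2 * p.1 + 2 * p.2 + 2) *
          qPoch (s ^ 2) (s ^ 2) p.2 * qPoch (s ^ 2) (s ^ 2) p.1))
      (qPochInf₃ ((s ^ 2) ^ 1) ((s ^ 2) ^ 12) ((s ^ 2) ^ 13) ((s ^ 2) ^ 13) /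
        qPochInf (s ^ 2) (s ^ 2)) := by
  have h := hasSum_double_odd hs hs0 (i := 1) (k := 12) rfl (by norm_num) (by norm_num)
    (w := fun _ => 1) continuous_const fun N => ?_
  · simpa only [mul_one] using h
  · rw [sum_antidiagonal_eq (pow_ne_zero 2 hs0) (w := fun z => z.2 * 1) 0 0 0 1 0 0
      fun n r _ => by ring]
    norm_num
    exact (gsum_odd_succ_three (norm_sq_lt_one hs) hs0 N).symm.trans (by push_cast; rfl)

theorem hasSum_double_two {s : ℂ} (hs : ‖s‖ < 1) (hs0 : s ≠ 0) :
    HasSum (fun p : ℕ × ℕ => (s ^ 2) ^ (p.1 ^ 2 + 2 * p.2 ^ 2 + 2 * p.1 * p.2 + 2 * p.1 + 3 * p.2) *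
        qPoch (s ^ 2) (s ^ 2) (p.1 + p.2 + 1) / (qPoch (s ^ 2) (s ^ 2) (2 * p.1 + 2 * p.2 + 2) *
          qPoch (s ^ 2) (s ^ 2) p.2 * qPoch (s ^ 2) (s ^ 2) p.1) *
        (1 + s ^ 2 * (s ^ 2) ^ p.2 + s ^ 2 * (s ^ 2) ^ p.1 -
          s ^ 2 * (s ^ 2) ^ p.1 * (s ^ 2) ^ p.2))
      (qPochInf₃ ((s ^ 2) ^ 2) ((s ^ 2) ^ 11) ((s ^ 2) ^ 13) ((s ^ 2) ^ 13) /
        qPochInf (s ^ 2) (s ^ 2)) := by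
  refine hasSum_double_odd hs hs0 (i := 2) (k := 11) rfl (by norm_num) (by norm_num)
    (w := fun z => 1 + s ^ 2 * z.2 + s ^ 2 * z.1 - s ^ 2 * z.1 * z.2) (by fun_prop) fun N => ?_
  rw [show ((11 : ℕ) : ℤ) - (2 : ℕ) - 8 = 1 by norm_num,
    gsum_odd_succ_one (norm_sq_lt_one hs) hs0,
    sum_antidiagonal_eq (pow_ne_zero 2 hs0)
    (w := fun z => z.2 * (1 + s ^ 2 * z.2 + s ^ 2 * z.1 - s ^ 2 * z.1 * z.2))
    0 0 ((s ^ 2) ^ (N + 1)) (1 - (s ^ 2) ^ (N + 1)) (s ^ 2) 0 fun n r hN => by subst hN; ring]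
  ring

theorem hasSum_double_three {s : ℂ} (hs : ‖s‖ < 1) (hs0 : s ≠ 0) :
    HasSum (fun p : ℕ × ℕ => (s ^ 2) ^ (p.1 ^ 2 + 2 * p.2 ^ 2 + 2 * p.1 * p.2 + 2 * p.1 + 3 * p.2) *
        qPoch (s ^ 2) (s ^ 2) (p.1 + p.2 + 1) / (qPoch (s ^ 2) (s ^ 2) (2 * p.1 + 2 * p.2 + 2) *
          qPoch (s ^ 2) (s ^ 2) p.2 * qPoch (s ^ 2) (s ^ 2) p.1) *
        ((1 - s ^ 2 * (s ^ 2) ^ p.1 * (s ^ 2) ^ p.2) * ((s ^ 2) ^ p.2 + (s ^ 2) ^ p.1) * (1 + s ^ 2)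
          - (s ^ 2) ^ p.1 * (s ^ 2) ^ p.2 + (s ^ 2) ^ 2 * ((s ^ 2) ^ p.2) ^ 2
          + (s ^ 2) ^ 2 * ((s ^ 2) ^ p.1) ^ 2
          + s ^ 2 * ((s ^ 2) ^ p.1) ^ 2 * ((s ^ 2) ^ p.2) ^ 2
          + (s ^ 2) ^ 2 * (s ^ 2) ^ p.1 * (s ^ 2) ^ p.2))
      (qPochInf₃ ((s ^ 2) ^ 3) ((s ^ 2) ^ 10) ((s ^ 2) ^ 13) ((s ^ 2) ^ 13) /
        qPochInf (s ^ 2) (s ^ 2)) := by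
  refine hasSum_double_odd hs hs0 (i := 3) (k := 10) rfl (by norm_num) (by norm_num)
    (w := fun z => (1 - s ^ 2 * z.1 * z.2) * (z.2 + z.1) * (1 + s ^ 2) - z.1 * z.2
      + (s ^ 2) ^ 2 * z.2 ^ 2 + (s ^ 2) ^ 2 * z.1 ^ 2 + s ^ 2 * z.1 ^ 2 * z.2 ^ 2
      + (s ^ 2) ^ 2 * z.1 * z.2) (by fun_prop) fun N => ?_
  rw [show ((10 : ℕ) : ℤ) - (3 : ℕ) - 8 = -1 by norm_num,
    gsum_odd_succ_neg_one (norm_sq_lt_one hs) hs0,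
    sum_antidiagonal_eq (pow_ne_zero 2 hs0)
    (w := fun z => z.2 * ((1 - s ^ 2 * z.1 * z.2) * (z.2 + z.1) * (1 + s ^ 2) - z.1 * z.2
      + (s ^ 2) ^ 2 * z.2 ^ 2 + (s ^ 2) ^ 2 * z.1 ^ 2 + s ^ 2 * z.1 ^ 2 * z.2 ^ 2
      + (s ^ 2) ^ 2 * z.1 * z.2))
    -- The coefficients come from substituting `z.1 = q^N / z.2` in the weight and collecting powers
    -- of `z.2 = q^r`.
    0 (((s ^ 2) ^ N) ^ 2 * (s ^ 2) ^ 2) ((1 - (s ^ 2) ^ N * s ^ 2) * (1 + s ^ 2) * (s ^ 2) ^ N)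
    (((s ^ 2) ^ N) ^ 2 * s ^ 2 + (s ^ 2) ^ N * (s ^ 2) ^ 2 - (s ^ 2) ^ N)
    ((1 - (s ^ 2) ^ N * s ^ 2) * (1 + s ^ 2)) ((s ^ 2) ^ 2) fun n r hN => by
      subst hN
      have : (s ^ 2) ^ r ≠ 0 := pow_ne_zero _ (pow_ne_zero 2 hs0)
      simp only [pow_add]
      generalize (s ^ 2) ^ r = x at *
      generalize (s ^ 2) ^ n = y
      field_simp
      ring]
  ring

theorem hasSum_double_four {s : ℂ} (hs : ‖s‖ < 1) (hs0 : s ≠ 0) :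
    HasSum (fun p : ℕ × ℕ => (s ^ 2) ^ (p.1 ^ 2 + 2 * p.2 ^ 2 + 2 * p.1 * p.2) *
        qPoch (s ^ 2) (s ^ 2) (p.1 + p.2) / (qPoch (s ^ 2) (s ^ 2) (2 * p.1 + 2 * p.2) *
          qPoch (s ^ 2) (s ^ 2) p.2 * qPoch (s ^ 2) (s ^ 2) p.1) *
        ((s ^ 2) ^ p.2 - 1 + s ^ 2 * ((s ^ 2) ^ p.2) ^ 2 + s ^ 2 * (s ^ 2) ^ p.1 * (s ^ 2) ^ p.2
          - (s ^ 2) ^ p.1 * ((s ^ 2) ^ p.2) ^ 2 + (s ^ 2) ^ p.1 + s ^ 2 * ((s ^ 2) ^ p.1) ^ 2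
          - ((s ^ 2) ^ p.1) ^ 2 * (s ^ 2) ^ p.2 - s ^ 2 * (s ^ 2) ^ p.1 * ((s ^ 2) ^ p.2) ^ 2
          - s ^ 2 * ((s ^ 2) ^ p.1) ^ 2 * (s ^ 2) ^ p.2 + ((s ^ 2) ^ p.1) ^ 2 * ((s ^ 2) ^ p.2) ^ 2))
      (s ^ 2 * (qPochInf₃ ((s ^ 2) ^ 4) ((s ^ 2) ^ 9) ((s ^ 2) ^ 13) ((s ^ 2) ^ 13) /
        qPochInf (s ^ 2) (s ^ 2))) := by
  refine hasSum_double_even hs hs0 (i := 4) (k := 9) rfl (by norm_num) (by norm_num)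
    (w := fun z => z.2 - 1 + s ^ 2 * z.2 ^ 2 + s ^ 2 * z.1 * z.2 - z.1 * z.2 ^ 2 + z.1
      + s ^ 2 * z.1 ^ 2 - z.1 ^ 2 * z.2 - s ^ 2 * z.1 * z.2 ^ 2 - s ^ 2 * z.1 ^ 2 * z.2
      + z.1 ^ 2 * z.2 ^ 2) (by fun_prop) fun N => ?_
  rw [show ((9 : ℕ) : ℤ) - (4 : ℕ) = 5 by norm_num, mul_gsum_even_five_eq (norm_sq_lt_one hs) hs0,
    sum_antidiagonal_eq (pow_ne_zero 2 hs0)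
    (w := fun z => z.2 - 1 + s ^ 2 * z.2 ^ 2 + s ^ 2 * z.1 * z.2 - z.1 * z.2 ^ 2 + z.1
      + s ^ 2 * z.1 ^ 2 - z.1 ^ 2 * z.2 - s ^ 2 * z.1 * z.2 ^ 2 - s ^ 2 * z.1 ^ 2 * z.2
      + z.1 ^ 2 * z.2 ^ 2)
    (((s ^ 2) ^ N) ^ 2 * s ^ 2) ((s ^ 2) ^ N - ((s ^ 2) ^ N) ^ 2 - ((s ^ 2) ^ N) ^ 2 * s ^ 2)
    ((s ^ 2) ^ N * s ^ 2 + ((s ^ 2) ^ N) ^ 2 - 1) (1 - (s ^ 2) ^ N - (s ^ 2) ^ N * s ^ 2) (s ^ 2) 0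
    fun n r hN => by
      subst hN
      have : (s ^ 2) ^ r ≠ 0 := pow_ne_zero _ (pow_ne_zero 2 hs0)
      simp only [pow_add]
      generalize (s ^ 2) ^ r = x at *
      generalize (s ^ 2) ^ n = y
      field_simp
      ring]
  ring

theorem hasSum_double_five {s : ℂ} (hs : ‖s‖ < 1) (hs0 : s ≠ 0) :
    HasSum (fun p : ℕ × ℕ => (s ^ 2) ^ (p.1 ^ 2 + 2 * p.2 ^ 2 + 2 * p.1 * p.2) *
        qPoch (s ^ 2) (s ^ 2) (p.1 + p.2) / (qPoch (s ^ 2) (s ^ 2) (2 * p.1 + 2 * p.2) *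
          qPoch (s ^ 2) (s ^ 2) p.2 * qPoch (s ^ 2) (s ^ 2) p.1) *
        ((s ^ 2) ^ p.1 + (s ^ 2) ^ p.2 - (s ^ 2) ^ p.1 * (s ^ 2) ^ p.2))
      (qPochInf₃ ((s ^ 2) ^ 5) ((s ^ 2) ^ 8) ((s ^ 2) ^ 13) ((s ^ 2) ^ 13) /
        qPochInf (s ^ 2) (s ^ 2)) := by
  rw [← one_mul (_ / qPochInf _ _)]
  refine hasSum_double_even hs hs0 (i := 5) (k := 8) rfl (by norm_num) (by norm_num)
    (w := fun z => z.1 + z.2 - z.1 * z.2) (by fun_prop) fun N => ?_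
  rw [show ((8 : ℕ) : ℤ) - (5 : ℕ) = 3 by norm_num, gsum_even_three (norm_sq_lt_one hs) hs0,
    sum_antidiagonal_eq (pow_ne_zero 2 hs0) (w := fun z => z.1 + z.2 - z.1 * z.2) 0 ((s ^ 2) ^ N) (-(s ^ 2) ^ N) 1 0 0
    fun n r hN => by
      subst hN
      have : (s ^ 2) ^ r ≠ 0 := pow_ne_zero _ (pow_ne_zero 2 hs0)
      simp only [pow_add]
      field_simp
      ring]
  ring

theorem hasSum_double_six {s : ℂ} (hs : ‖s‖ < 1) (hs0 : s ≠ 0) :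
    HasSum (fun p : ℕ × ℕ => (s ^ 2) ^ (p.1 ^ 2 + 2 * p.2 ^ 2 + 2 * p.1 * p.2) *
        qPoch (s ^ 2) (s ^ 2) (p.1 + p.2) / (qPoch (s ^ 2) (s ^ 2) (2 * p.1 + 2 * p.2) *
          qPoch (s ^ 2) (s ^ 2) p.2 * qPoch (s ^ 2) (s ^ 2) p.1))
      (qPochInf₃ ((s ^ 2) ^ 6) ((s ^ 2) ^ 7) ((s ^ 2) ^ 13) ((s ^ 2) ^ 13) /
        qPochInf (s ^ 2) (s ^ 2)) := by
  have h := hasSum_double_even hs hs0 (i := 6) (k := 7) rfl (by norm_num) (by norm_num)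
    (w := fun _ => 1) (x := 1) continuous_const fun N => ?_
  · simpa only [mul_one, one_mul] using h
  · rw [show ((7 : ℕ) : ℤ) - (6 : ℕ) = 1 by norm_num, (gsum_eq_rsum (norm_sq_lt_one hs) hs0 N).1,
      sum_antidiagonal_eq (pow_ne_zero 2 hs0) (w := fun _ => 1) 0 0 1 0 0 0 fun n r _ => by ring]
    ring

/-! ### The degenerate case `q = 0` and the conclusion -/

theorem qPoch_zero_zero (m : ℕ) : qPoch 0 0 m = 1 := by simp [qPoch]

theorem qPochInf_zero (q : ℂ) : qPochInf 0 q = 1 := by simp [qPochInf]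

/-- A double series with constant term `1` and no other nonzero term has sum `1`. -/
theorem hasSum_one_of_eq_zero_of_ne {f : ℕ × ℕ → ℂ} (h : ∀ p ≠ (0, 0), f p = 0) (h0 : f (0, 0) = 1) :
    HasSum f 1 := by
  rw [← h0]
  exact hasSum_single _ h

end QSeries

end

theorem mainTheorem10 (q : ℂ) (hq : ‖q‖ < 1) :
    HasSum
      (fun p : ℕ × ℕ => let n := p.1; let r := p.2
        q ^ (n ^ 2 + 2 * r ^ 2 + 2 * n * r + 2 * n + 3 * r) * QSeries.qPoch q q (n + r + 1) /
          (QSeries.qPoch q q (2 * n + 2 * r + 2) * QSeries.qPoch q q r * QSeries.qPoch q q n))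
      (QSeries.qPochInf₃ (q ^ 1) (q ^ 12) (q ^ 13) (q ^ 13) / QSeries.qPochInf q q) ∧
    HasSum
      (fun p : ℕ × ℕ => let n := p.1; let r := p.2
        q ^ (n ^ 2 + 2 * r ^ 2 + 2 * n * r + 2 * n + 3 * r) * QSeries.qPoch q q (n + r + 1) *
          (1 + q ^ (r + 1) + q ^ (n + 1) - q ^ (n + r + 1)) /
          (QSeries.qPoch q q (2 * n + 2 * r + 2) * QSeries.qPoch q q r * QSeries.qPoch q q n))
      (QSeries.qPochInf₃ (q ^ 2) (q ^ 11) (q ^ 13) (q ^ 13) / QSeries.qPochInf q q) ∧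
    HasSum
      (fun p : ℕ × ℕ => let n := p.1; let r := p.2
        q ^ (n ^ 2 + 2 * r ^ 2 + 2 * n * r + 2 * n + 3 * r) * QSeries.qPoch q q (n + r + 1) /
          (QSeries.qPoch q q (2 * n + 2 * r + 2) * QSeries.qPoch q q r * QSeries.qPoch q q n) *
          ((1 - q ^ (n + r + 1)) * (q ^ r + q ^ n) * (1 + q) - q ^ (n + r) + q ^ (2 * r + 2)
            + q ^ (2 * n + 2) + q ^ (2 * n + 2 * r + 1) + q ^ (n + r + 2)))
      (QSeries.qPochInf₃ (q ^ 3) (q ^ 10) (q ^ 13) (q ^ 13) / QSeries.qPochInf q q) ∧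
    (q ≠ 0 → HasSum
      (fun p : ℕ × ℕ => let n := p.1; let r := p.2
        q ^ ((n : ℤ) ^ 2 + 2 * (r : ℤ) ^ 2 + 2 * (n : ℤ) * (r : ℤ) - 1) *
          QSeries.qPoch q q (n + r) /
          (QSeries.qPoch q q (2 * n + 2 * r) * QSeries.qPoch q q r * QSeries.qPoch q q n) *
          (q ^ r - 1 + q ^ (2 * r + 1) + q ^ (n + r + 1) - q ^ (n + 2 * r) + q ^ n
            + q ^ (2 * n + 1) - q ^ (2 * n + r) - q ^ (n + 2 * r + 1)
            - q ^ (2 * n + r + 1) + q ^ (2 * n + 2 * r)))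
      (QSeries.qPochInf₃ (q ^ 4) (q ^ 9) (q ^ 13) (q ^ 13) / QSeries.qPochInf q q)) ∧
    HasSum
      (fun p : ℕ × ℕ => let n := p.1; let r := p.2
        q ^ (n ^ 2 + 2 * r ^ 2 + 2 * n * r) * QSeries.qPoch q q (n + r) *
          (q ^ n + q ^ r - q ^ (n + r)) /
          (QSeries.qPoch q q (2 * n + 2 * r) * QSeries.qPoch q q r * QSeries.qPoch q q n))
      (QSeries.qPochInf₃ (q ^ 5) (q ^ 8) (q ^ 13) (q ^ 13) / QSeries.qPochInf q q) ∧
    HasSum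
      (fun p : ℕ × ℕ => let n := p.1; let r := p.2
        q ^ (n ^ 2 + 2 * r ^ 2 + 2 * n * r) * QSeries.qPoch q q (n + r) /
          (QSeries.qPoch q q (2 * n + 2 * r) * QSeries.qPoch q q r * QSeries.qPoch q q n))
      (QSeries.qPochInf₃ (q ^ 6) (q ^ 7) (q ^ 13) (q ^ 13) / QSeries.qPochInf q q) := by
  rcases eq_or_ne q 0 with rfl | hq0
  · have hz : ∀ (i k : ℕ), i ≠ 0 → k ≠ 0 →
        QSeries.qPochInf₃ (0 ^ i) (0 ^ k) (0 ^ 13) (0 ^ 13) / QSeries.qPochInf 0 0 = 1 :=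
      fun i k hi hk => by
        simp [QSeries.qPochInf₃, QSeries.qPochInf_zero, hi, hk]
    have he : ∀ p : ℕ × ℕ, p ≠ (0, 0) → p.1 ^ 2 + 2 * p.2 ^ 2 + 2 * p.1 * p.2 ≠ 0 := by
      rintro ⟨n, r⟩ hp h
      have h1 : n ^ 2 = 0 := by simp only at h; omega
      have h2 : r ^ 2 = 0 := by simp only at h; omega
      exact hp (by simp_all)
    have he' : ∀ p : ℕ × ℕ, p ≠ (0, 0) →
        p.1 ^ 2 + 2 * p.2 ^ 2 + 2 * p.1 * p.2 + 2 * p.1 + 3 * p.2 ≠ 0 := fun p hp h =>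
      he p hp (by omega)
    refine ⟨?_, ?_, ?_, fun h => absurd rfl h, ?_, ?_⟩ <;> rw [hz _ _ (by norm_num) (by norm_num)]
    · exact QSeries.hasSum_one_of_eq_zero_of_ne (fun p hp => by
        simp only [zero_pow (he' p hp), zero_mul, zero_div])
        (by simp [QSeries.qPoch_zero_zero])
    · exact QSeries.hasSum_one_of_eq_zero_of_ne (fun p hp => by
        simp only [zero_pow (he' p hp), zero_mul, zero_div])
        (by simp [QSeries.qPoch_zero_zero])
    · exact QSeries.hasSum_one_of_eq_zero_of_ne (fun p hp => by
        simp only [zero_pow (he' p hp), zero_mul, zero_div])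
        (by simp [QSeries.qPoch_zero_zero])
    · exact QSeries.hasSum_one_of_eq_zero_of_ne (fun p hp => by
        simp only [zero_pow (he p hp), zero_mul, zero_div])
        (by simp [QSeries.qPoch_zero_zero])
    · exact QSeries.hasSum_one_of_eq_zero_of_ne (fun p hp => by
        simp only [zero_pow (he p hp), zero_mul, zero_div])
        (by simp [QSeries.qPoch_zero_zero])
  -- A square root of `q` lets the exponents `j(5j+a)/2` be written without division.
  · obtain ⟨s, rfl⟩ := IsAlgClosed.exists_pow_nat_eq q two_pos
    have hs : ‖s‖ < 1 := by
      rw [norm_pow] at hq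
      exact (pow_lt_one_iff_of_nonneg (norm_nonneg s) two_ne_zero).mp hq
    have hs0 : s ≠ 0 := fun h => hq0 (by rw [h, zero_pow two_ne_zero])
    refine ⟨QSeries.hasSum_double_one hs hs0,
      (QSeries.hasSum_double_two hs hs0).congr_fun fun p => ?_,
      (QSeries.hasSum_double_three hs hs0).congr_fun fun p => ?_, fun _ => ?_,
      (QSeries.hasSum_double_five hs hs0).congr_fun fun p => ?_,
      QSeries.hasSum_double_six hs hs0⟩
    · ring
    · ring
    -- The fourth series was summed with an extra factor `q`; removing it produces the exponent `-
    -- 1`.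
    · have h := (QSeries.hasSum_double_four hs hs0).mul_left (s ^ 2)⁻¹
      rw [inv_mul_cancel_left₀ hq0] at h
      refine h.congr_fun fun p => ?_
      simp only
      rw [show (p.1 : ℤ) ^ 2 + 2 * (p.2 : ℤ) ^ 2 + 2 * p.1 * p.2 - 1 =
        (p.1 ^ 2 + 2 * p.2 ^ 2 + 2 * p.1 * p.2 : ℕ) - 1 by push_cast; ring, zpow_sub_one₀ hq0,
        zpow_natCast]
      ring
    · ring
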